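/- Let $\Bbbk$ be an algebraically closed field of characteristic $p>0$. For a finitely generated free abelian group $M$, let $T_M=\operatorname{Spec}\Bbbk[M]$, and for a finite subset $A=\{u_0,\dots,u_N\}\subset M$ (with $N=\#A-1$) let $X_A\subset\mathbb P^{\#A-1}$ be the Zariski closure of the image of $T_M\to\mathbb P^N$, $t\mapsto[z^{u_0}(t):\cdots:z^{u_N}(t)]$. Write $\operatorname{Aff}(A)\subset M$ for the set of all combinations $\sum_i a_iu_i$ with $a_i\in\mathbb Z$ and $\sum_i a_i=1$. For a projective variety $X\subset\mathbb P^N$ of dimension $n$, the Gauss map $\gamma\colon X\dashrightarrow\mathbb G(n,\mathbb P^N)$ sends a smooth point to the embedded tangent space of $X$ at that point; the Grassmannian is embedded in a projective space by the Plücker embedding, and fibers of $\gamma$ (in the set of smooth points of $X$) are taken with the reduced structure. A statement holds for a general fiber of $\gamma$ if it holds for the fibers over all points of some nonempty open subset of $\overline{\gamma(X)}$. Two subvarieties $X_1\subset\mathbb P^{N_1}$, $X_2\subset\mathbb P^{N_2}$ are projectively equivalent if there are linear embeddings $j_i\colon\mathbb P^{N_i}\hookrightarrow\mathbb P^N$ with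 $j_1(X_1)=j_2(X_2)$. **Theorem.** Let $A'$ and $A''$ be finite subsets of free abelian groups $M'$ and $M''$ of finite rank such that $\operatorname{Aff}(A')=M'$ and $\operatorname{Aff}(A'')=M''$. Let $c>0$ be an integer coprime to $p$. Assume $n:=\operatorname{rk}(M')+\operatorname{rk}(M'')\ge\#A'-1$ and $\operatorname{rk}(M'')\ge1$. Then there exists a finite subset $A\subset\mathbb Z^n$ with $\#A=n+\#A''$ and $\operatorname{Aff}(A)=\mathbb Z^n$ such that the Gauss map $\gamma$ of $X_A\subset\mathbb P^{\#A-1}$ satisfies: 1. the closure of each irreducible component of a general fiber of $\gamma$ is projectively equivalent to $X_{A'}$; 2. the closure of the image $\gamma(X_A)$ is projectively equivalent to $X_{A''}$; 3. the number of irreducible components of a general fiber of $\gamma$ is equal to $c$. -/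

import Mathlib

open scoped LinearAlgebra.Projectivization

namespace GaussToric

noncomputable section

universe u v w

/-! ### Projective space with its Zariski topology

Throughout, `𝕜` is a field (algebraically closed in the theorem), a projective space is the set
`ℙ 𝕜 (ι → 𝕜)` of its `𝕜`-points with homogeneous coordinates indexed by `ι`, and a variety is
identified with its set of `𝕜`-points. -/

section Zariski

variable {𝕜 : Type u} [Field 𝕜] {ι : Type v}

/-- The common zero locus in projective space of a set of polynomials (used for sets of
homogeneous polynomials, for which the choice of homogeneous coordinates is irrelevant). -/
def projZeroLocus (S : Set (MvPolynomial ι 𝕜)) : Set (ℙ 𝕜 (ι → 𝕜)) :=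
  {P | ∀ F ∈ S, MvPolynomial.eval P.rep F = 0}

/-- Zariski closed subsets: zero loci of sets of homogeneous polynomials. -/
def IsZariskiClosed (Z : Set (ℙ 𝕜 (ι → 𝕜))) : Prop :=
  ∃ S : Set (MvPolynomial ι 𝕜), (∀ F ∈ S, ∃ d : ℕ, F.IsHomogeneous d) ∧ Z = projZeroLocus S

/-- The Zariski topology on projective space. -/
instance zariskiTopology : TopologicalSpace (ℙ 𝕜 (ι → 𝕜)) :=
  TopologicalSpace.ofClosed {Z | IsZariskiClosed Z}
    (by
      refine ⟨{1}, ?_, ?_⟩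
      · rintro F rfl
        exact ⟨0, MvPolynomial.isHomogeneous_one ι 𝕜⟩
      · ext P
        simp [projZeroLocus])
    (by
      intro 𝒵 h𝒵
      refine ⟨{F | (∃ d : ℕ, F.IsHomogeneous d) ∧
        ∃ Z ∈ 𝒵, ∀ P ∈ Z, MvPolynomial.eval P.rep F = 0}, fun F hF => hF.1, ?_⟩
      ext P
      simp only [Set.mem_sInter, projZeroLocus, Set.mem_ofPred_eq]
      constructor
      · rintro h F ⟨-, Z, hZ, hF⟩
        exact hF P (h Z hZ)
      · intro h Z hZ
        obtain ⟨S, hS, rfl⟩ := h𝒵 hZ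
        intro F hF
        exact h F ⟨hS F hF, _, hZ, fun Q hQ => hQ F hF⟩)
    (by
      rintro Z₁ ⟨S₁, hS₁, rfl⟩ Z₂ ⟨S₂, hS₂, rfl⟩
      refine ⟨{F | ∃ F₁ ∈ S₁, ∃ F₂ ∈ S₂, F = F₁ * F₂}, ?_, ?_⟩
      · rintro F ⟨F₁, h₁, F₂, h₂, rfl⟩
        obtain ⟨d₁, hd₁⟩ := hS₁ F₁ h₁
        obtain ⟨d₂, hd₂⟩ := hS₂ F₂ h₂
        exact ⟨d₁ + d₂, hd₁.mul hd₂⟩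
      · ext P
        constructor
        · rintro (h | h) F ⟨F₁, h₁, F₂, h₂, rfl⟩
          · simp [h F₁ h₁]
          · simp [h F₂ h₂]
        · intro h
          by_contra hP
          simp only [Set.mem_union, not_or, projZeroLocus, Set.mem_ofPred_eq, not_forall] at hP
          obtain ⟨⟨F₁, h₁, h₁'⟩, ⟨F₂, h₂, h₂'⟩⟩ := hP
          have := h (F₁ * F₂) ⟨F₁, h₁, F₂, h₂, rfl⟩
          rw [map_mul, mul_eq_zero] at this
          exact this.elim h₁' h₂')

/-- `X₁ ⊆ ℙ^{N₁}` and `X₂ ⊆ ℙ^{N₂}` are projectively equivalent if some linear embeddings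
`j₁ : ℙ^{N₁} → ℙ^N` and `j₂ : ℙ^{N₂} → ℙ^N` satisfy `j₁(X₁) = j₂(X₂)`. -/
def ProjectivelyEquivalent {ι₁ : Type v} {ι₂ : Type w}
    (X₁ : Set (ℙ 𝕜 (ι₁ → 𝕜))) (X₂ : Set (ℙ 𝕜 (ι₂ → 𝕜))) : Prop :=
  ∃ (N : ℕ) (j₁ : (ι₁ → 𝕜) →ₗ[𝕜] (Fin (N + 1) → 𝕜)) (h₁ : Function.Injective j₁)
    (j₂ : (ι₂ → 𝕜) →ₗ[𝕜] (Fin (N + 1) → 𝕜)) (h₂ : Function.Injective j₂),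
    Projectivization.map j₁ h₁ '' X₁ = Projectivization.map j₂ h₂ '' X₂

end Zariski

/-! ### Embedded tangent spaces and the Gauss map -/

section GaussMap

variable {𝕜 : Type u} [Field 𝕜] {ι : Type v}

/-- The affine cone over a subset of projective space (with the vertex `0`). -/
def affineCone (X : Set (ℙ 𝕜 (ι → 𝕜))) : Set (ι → 𝕜) :=
  {x | ∀ hx : x ≠ 0, Projectivization.mk 𝕜 x hx ∈ X}

/-- The ideal `I(X)` of `X`, i.e. the ideal of all polynomials that vanish on the affine cone. -/
def idealOf (X : Set (ℙ 𝕜 (ι → 𝕜))) : Ideal (MvPolynomial ι 𝕜) :=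
  MvPolynomial.vanishingIdeal 𝕜 (affineCone X)

/-- The dimension of the affine cone over `X`, so that `coneDim X = dim X + 1` for a projective
variety `X`: the transcendence degree over `𝕜` of the homogeneous coordinate ring of `X`. -/
def coneDim (X : Set (ℙ 𝕜 (ι → 𝕜))) : ℕ :=
  Cardinal.toNat (Algebra.trdeg 𝕜 (MvPolynomial ι 𝕜 ⧸ idealOf X))

variable [Fintype ι]

/-- The Zariski tangent space at `x` of the affine cone over `X`, as a linear subspace of the
ambient space. -/
def coneTangentSpace (X : Set (ℙ 𝕜 (ι → 𝕜))) (x : ι → 𝕜) : Submodule 𝕜 (ι → 𝕜) where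
  carrier := {y | ∀ F ∈ idealOf X,
    ∑ i, MvPolynomial.eval x (MvPolynomial.pderiv i F) * y i = 0}
  zero_mem' := by intro F _; simp
  add_mem' := by
    intro y z hy hz F hF
    simp only [Pi.add_apply, mul_add, Finset.sum_add_distrib]
    rw [hy F hF, hz F hF, add_zero]
  smul_mem' := by
    intro c y hy F hF
    have : ∀ i, MvPolynomial.eval x (MvPolynomial.pderiv i F) * (c • y) i =
        c * (MvPolynomial.eval x (MvPolynomial.pderiv i F) * y i) := by
      intro i
      simp only [Pi.smul_apply, smul_eq_mul]
      ring
    simp only [this, ← Finset.mul_sum]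
    rw [hy F hF, mul_zero]

/-- The embedded tangent space `𝕋_P X` of `X` at `P`, as the linear subspace of `𝕜^{N+1}` whose
projectivization it is. -/
def embeddedTangentSpace (X : Set (ℙ 𝕜 (ι → 𝕜))) (P : ℙ 𝕜 (ι → 𝕜)) : Submodule 𝕜 (ι → 𝕜) :=
  coneTangentSpace X P.rep

/-- The set of smooth points of `X`: the points where the tangent space has the dimension
of `X`. -/
def smoothLocus (X : Set (ℙ 𝕜 (ι → 𝕜))) : Set (ℙ 𝕜 (ι → 𝕜)) :=
  {P | P ∈ X ∧ Module.finrank 𝕜 (embeddedTangentSpace X P) = coneDim X}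

/-- The Plücker coordinates `p_{i₁,…,i_m}`, `i₁ < ⋯ < i_m`, of `m` vectors: the maximal minors of
the matrix whose rows are these vectors. -/
def pluckerCoords [LinearOrder ι] {m : ℕ} (b : Fin m → ι → 𝕜) : (Fin m ↪o ι) → 𝕜 :=
  fun s => (Matrix.of fun r c => b r (s c)).det

/-- The Plücker coordinates of linearly independent vectors do not all vanish. -/
theorem pluckerCoords_ne_zero [LinearOrder ι] {m : ℕ} (b : Fin m → ι → 𝕜)
    (hb : LinearIndependent 𝕜 b) : pluckerCoords b ≠ 0 := by
  classical
  have hspan : Submodule.span 𝕜 (Set.range fun i : ι => fun r : Fin m => b r i) = ⊤ := by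
    have h := hb.rank_matrix (M := Matrix.of b)
    rw [Matrix.rank_eq_finrank_span_cols] at h
    refine Submodule.eq_top_of_finrank_eq ?_
    rw [Module.finrank_pi]
    exact h
  obtain ⟨κ, a, ha, hsp, hli⟩ :=
    exists_linearIndependent' 𝕜 (fun i : ι => fun r : Fin m => b r i)
  rw [hspan] at hsp
  have : Fintype κ := Fintype.ofInjective a ha
  have hcard : Fintype.card κ = m := by
    have := finrank_span_eq_card hli
    rw [hsp, finrank_top, Module.finrank_pi, Fintype.card_fin] at this
    exact this.symm
  have hs : (Finset.univ.image a).card = m := by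
    rw [Finset.card_image_of_injective _ ha, Finset.card_univ, hcard]
  let s : Fin m ↪o ι := (Finset.univ.image a).orderEmbOfFin hs
  have hmem : ∀ c, ∃ j, a j = s c := by
    intro c
    have h := Finset.orderEmbOfFin_mem (Finset.univ.image a) hs c
    obtain ⟨j, -, hj⟩ := Finset.mem_image.mp h
    exact ⟨j, hj⟩
  choose g hg using hmem
  have hginj : Function.Injective g := by
    intro c d hcd
    apply s.injective
    rw [← hg, ← hg, hcd]
  have hli' := hli.comp g hginj
  intro h0
  have hdet : (Matrix.of fun r c => b r (s c)).det = 0 := congrFun h0 s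
  have hunit : IsUnit (Matrix.of fun r c => b r (s c)) := by
    rw [← Matrix.linearIndependent_cols_iff_isUnit]
    have hcol : (Matrix.of fun r c => b r (s c)).col =
        ((fun i : ι => fun r : Fin m => b r i) ∘ a) ∘ g := by
      funext c r
      simp [Matrix.col, hg]
    rw [hcol]
    exact hli'
  rw [Matrix.isUnit_iff_isUnit_det, hdet] at hunit
  exact not_isUnit_zero hunit

/-- The Plücker embedding: the point of projective space that represents an `m`-dimensional
linear subspace `W`, computed with any basis of `W`. -/
def plucker [LinearOrder ι] {m : ℕ} (W : Submodule 𝕜 (ι → 𝕜)) (hW : Module.finrank 𝕜 W = m) :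
    ℙ 𝕜 ((Fin m ↪o ι) → 𝕜) :=
  Projectivization.mk 𝕜
    (pluckerCoords fun r => (Module.finBasisOfFinrankEq 𝕜 W hW r : ι → 𝕜))
    (pluckerCoords_ne_zero _
      ((Module.finBasisOfFinrankEq 𝕜 W hW).linearIndependent.map' W.subtype W.ker_subtype))

/-- The Gauss map of `X`, which sends a smooth point to the embedded tangent space there; the
Grassmannian is embedded in a projective space by the Plücker embedding. -/
def gaussMap [LinearOrder ι] (X : Set (ℙ 𝕜 (ι → 𝕜))) :
    smoothLocus X → ℙ 𝕜 ((Fin (coneDim X) ↪o ι) → 𝕜) :=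
  fun P => plucker (embeddedTangentSpace X P) P.2.2

/-- The closure of the image of the Gauss map. -/
def gaussImage [LinearOrder ι] (X : Set (ℙ 𝕜 (ι → 𝕜))) :
    Set (ℙ 𝕜 ((Fin (coneDim X) ↪o ι) → 𝕜)) :=
  closure (Set.range (gaussMap X))

/-- The fiber of the Gauss map over `y` (with the reduced structure), as a subset of the ambient
projective space. -/
def gaussFiber [LinearOrder ι] (X : Set (ℙ 𝕜 (ι → 𝕜)))
    (y : ℙ 𝕜 ((Fin (coneDim X) ↪o ι) → 𝕜)) : Set (ℙ 𝕜 (ι → 𝕜)) :=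
  Subtype.val '' (gaussMap X ⁻¹' {y})

/-- The property `Q` holds for a general fiber of the Gauss map of the irreducible variety `X`:
it holds for the fibers over all points of some nonempty open subset of the closure of the
image. -/
def ForGeneralGaussFiber [LinearOrder ι] (X : Set (ℙ 𝕜 (ι → 𝕜)))
    (Q : Set (ℙ 𝕜 (ι → 𝕜)) → Prop) : Prop :=
  ∃ U : Set (ℙ 𝕜 ((Fin (coneDim X) ↪o ι) → 𝕜)), IsOpen U ∧ (U ∩ gaussImage X).Nonempty ∧
    ∀ y ∈ U ∩ gaussImage X, Q (gaussFiber X y)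

end GaussMap

/-! ### Toric varieties -/

section Toric

variable (𝕜 : Type u) [Field 𝕜] {M : Type w} [AddCommGroup M]

/-- The `𝕜`-points of the torus `T_M = Spec 𝕜[M]`: the characters `M → 𝕜ˣ`. -/
abbrev Torus (M : Type w) [AddCommGroup M] : Type max u w := Multiplicative M →* 𝕜ˣ

variable {𝕜} in
/-- The value `z^u(t)` of the monomial `z^u` at the point `t` of the torus. -/
def monomialValue (t : Torus 𝕜 M) (u : M) : 𝕜 := (t (Multiplicative.ofAdd u) : 𝕜ˣ)

/-- The homogeneous coordinates on `ℙ^{#A-1}` are numbered by `Fin #A` through an enumeration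
`u_0, …, u_N` of `A`. -/
def enum (A : Finset M) : Fin A.card → M := fun i => (A.equivFin.symm i : M)

/-- The image of `φ_A : T_M → ℙ^{#A-1}`, `t ↦ [z^{u_0}(t) : ⋯ : z^{u_N}(t)]`. -/
def torusImage (A : Finset M) : Set (ℙ 𝕜 (Fin A.card → 𝕜)) :=
  {P | ∃ (t : Torus 𝕜 M) (h : (fun i => monomialValue t (enum A i)) ≠ 0),
    P = Projectivization.mk 𝕜 (fun i => monomialValue t (enum A i)) h}

/-- The projective toric variety `X_A ⊆ ℙ^{#A-1}`: the closure of the image of `φ_A`. -/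
def toricVariety (A : Finset M) : Set (ℙ 𝕜 (Fin A.card → 𝕜)) :=
  closure (torusImage 𝕜 A)

end Toric

end

end GaussToric

/-! Choose a surjection π : ℤ^n → M' whose values on the standard basis vectors e_i are the nonzero
elements of A' - u₀', filled up with zeros; there is room for this because #A' - 1 ≤ n. Split it to
an isomorphism E : ℤ^n ≃ M' × M'' with first component π. Let S be the endomorphism of M'' that
multiplies one basis vector by c and fixes the others, put w_j = E⁻¹(0, S(u_j - u_o)) for u_j ∈ A'',
and let A consist of the e_i and the p w_j. Write x_i and y_j for the corresponding coordinates.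

In characteristic p the monomials z^{p w_j} have zero logarithmic derivatives. So the tangent space
of the cone at a torus point t is the whole coordinate space of the x_i plus the line through (z^{p
w_j}(t))_j. Hence γ is t ↦ [z^{p w_j}(t)] followed by a linear embedding in the Plücker space
(`gaussMap_eq`, `gaussImage_variety`). As p S is injective and 𝕜 is algebraically closed, the p w_j
parametrize the same set as A'' (`monomialImage_smul_w_eq`).

On the torus a fiber is a coset of {h : h^{p w_j} = 1}. The factor p is invisible on points, because
p-th roots are unique, and the rest of this group is the product of T_{M'} and the group of c-th
roots of unity. So there are c cosets of T_{M'}. On each of them the exponents become π(e_i) and π(p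
w_j) = 0, which form A' - u₀', and the closure is X_{A'} up to a diagonal rescaling and repetition
of coordinates.

The image and the fibers of γ also involve smooth points outside the torus. The partial derivatives
∂F/∂x_i of F ∈ I(X) lie in I(X) again (`pderiv_inl_mem_idealOf`), so at every point the tangent
space contains all x_i-directions, and at a smooth point one line in the y-space remains. By
Cramer's rule this line is given near the point by polynomials (`exists_polynomials_yTangent`). This
extends identities from the torus and places the point in the closure of the torus part of the fiber
(`mem_closure_of_yTangent_eq`). The main algebraic tool is the linear independence of characters. -/

namespace GaussToric

/-! ### Closures and linear maps in the Zariski topology. -/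

section ZariskiTopology

variable {𝕜 : Type*} [Field 𝕜] {ι ι₁ ι₂ : Type*}

theorem eval_smul_of_isHomogeneous {F : MvPolynomial ι 𝕜} {d : ℕ} (hF : F.IsHomogeneous d)
    (s : 𝕜) (x : ι → 𝕜) :
    MvPolynomial.eval (s • x) F = s ^ d * MvPolynomial.eval x F := by
  rw [MvPolynomial.eval_eq, MvPolynomial.eval_eq, Finset.mul_sum]
  refine Finset.sum_congr rfl fun m hm => ?_
  have hdeg : ∑ i ∈ m.support, m i = d := by
    have := hF (MvPolynomial.mem_support_iff.mp hm)
    simpa [Finsupp.weight_apply, Finsupp.sum] using this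
  simp only [Pi.smul_apply, smul_eq_mul, mul_pow, Finset.prod_mul_distrib]
  rw [Finset.prod_pow_eq_pow_sum, hdeg]
  ring

theorem eval_rep_mk_eq_zero_iff {F : MvPolynomial ι 𝕜} {d : ℕ} (hF : F.IsHomogeneous d)
    (x : ι → 𝕜) (hx : x ≠ 0) :
    MvPolynomial.eval (Projectivization.mk 𝕜 x hx).rep F = 0 ↔ MvPolynomial.eval x F = 0 := by
  obtain ⟨a, ha⟩ := Projectivization.exists_smul_eq_mk_rep 𝕜 x hx
  rw [← ha, Units.smul_def, eval_smul_of_isHomogeneous hF]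
  simp

theorem isClosed_iff_isZariskiClosed {Z : Set (ℙ 𝕜 (ι → 𝕜))} :
    IsClosed Z ↔ IsZariskiClosed Z := by
  rw [← isOpen_compl_iff]
  change Zᶜᶜ ∈ {Z | IsZariskiClosed Z} ↔ _
  rw [compl_compl]
  rfl

theorem isClosed_zeroLocus {F : MvPolynomial ι 𝕜} {d : ℕ} (hF : F.IsHomogeneous d) :
    IsClosed {P : ℙ 𝕜 (ι → 𝕜) | MvPolynomial.eval P.rep F = 0} :=
  isClosed_iff_isZariskiClosed.mpr ⟨{F}, by rintro G rfl; exact ⟨d, hF⟩, by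
    ext P; simp [projZeroLocus]⟩

theorem mem_closure_iff_forall_eval {S : Set (ℙ 𝕜 (ι → 𝕜))} {P : ℙ 𝕜 (ι → 𝕜)} :
    P ∈ closure S ↔ ∀ (F : MvPolynomial ι 𝕜) (d : ℕ), F.IsHomogeneous d →
      (∀ Q ∈ S, MvPolynomial.eval Q.rep F = 0) → MvPolynomial.eval P.rep F = 0 := by
  constructor
  · intro hP F d hF hS
    have hsub : closure S ⊆ {P | MvPolynomial.eval P.rep F = 0} :=
      closure_minimal (fun Q hQ => Set.mem_ofPred.mpr (hS Q hQ)) (isClosed_zeroLocus hF)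
    exact Set.mem_ofPred.mp (hsub hP)
  · intro h
    obtain ⟨T, hT, hZ⟩ := isClosed_iff_isZariskiClosed.mp (isClosed_closure (s := S))
    rw [hZ]
    intro F hF
    obtain ⟨d, hd⟩ := hT F hF
    refine h F d hd fun Q hQ => ?_
    have hQ' := subset_closure hQ
    rw [hZ] at hQ'
    exact hQ' F hF

/-- The pullback of a polynomial along a linear map. -/
noncomputable def linearPullback [Fintype ι₁] [DecidableEq ι₁] (j : (ι₁ → 𝕜) →ₗ[𝕜] (ι₂ → 𝕜))
    (F : MvPolynomial ι₂ 𝕜) : MvPolynomial ι₁ 𝕜 :=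
  MvPolynomial.bind₁
    (fun i => ∑ k, MvPolynomial.C (j (Pi.single k 1) i) * MvPolynomial.X k) F

theorem eval_linearPullback [Fintype ι₁] [DecidableEq ι₁] (j : (ι₁ → 𝕜) →ₗ[𝕜] (ι₂ → 𝕜))
    (F : MvPolynomial ι₂ 𝕜) (x : ι₁ → 𝕜) :
    MvPolynomial.eval x (linearPullback j F) = MvPolynomial.eval (j x) F := by
  have hx : (fun i => ∑ k, j (Pi.single k 1) i * x k) = j x := by
    conv_rhs => rw [← Finset.univ_sum_single x]
    funext i
    rw [map_sum, Finset.sum_apply]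
    refine Finset.sum_congr rfl fun k _ => ?_
    have : Pi.single k (x k) = x k • (Pi.single k 1 : ι₁ → 𝕜) := by
      rw [← Pi.single_smul]; simp
    rw [this, map_smul, Pi.smul_apply, smul_eq_mul, mul_comm]
  rw [linearPullback, MvPolynomial.eval, MvPolynomial.eval₂Hom_bind₁]
  simp only [map_sum, map_mul, MvPolynomial.eval₂Hom_C, MvPolynomial.eval₂Hom_X', RingHom.id_apply]
  rw [hx]
  rfl

theorem isHomogeneous_linearPullback [Fintype ι₁] [DecidableEq ι₁]
    (j : (ι₁ → 𝕜) →ₗ[𝕜] (ι₂ → 𝕜)) {F : MvPolynomial ι₂ 𝕜} {d : ℕ} (hF : F.IsHomogeneous d) :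
    (linearPullback j F).IsHomogeneous d := by
  have := hF.eval₂ (n := 1) MvPolynomial.C
    (fun i => ∑ k, MvPolynomial.C (j (Pi.single k 1) i) * (MvPolynomial.X k : MvPolynomial ι₁ 𝕜))
    (fun r => MvPolynomial.isHomogeneous_C _ _)
    (fun i => MvPolynomial.IsHomogeneous.sum _ _ _ fun k _ => by
      simpa using (MvPolynomial.isHomogeneous_C ι₁ (j (Pi.single k 1) i)).mul
        (MvPolynomial.isHomogeneous_X 𝕜 k))
  rwa [one_mul] at this

/-- The range of `j` is cut out by linear forms, so the closure stays inside it; within the range,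
equations are transported by pulling back along `j` and along a linear left inverse of `j`. -/
theorem closure_image_map [Finite ι₁] [Finite ι₂] (j : (ι₁ → 𝕜) →ₗ[𝕜] (ι₂ → 𝕜))
    (hj : Function.Injective j) (S : Set (ℙ 𝕜 (ι₁ → 𝕜))) :
    closure (Projectivization.map j hj '' S) = Projectivization.map j hj '' closure S := by
  classical
  have := Fintype.ofFinite ι₁
  have := Fintype.ofFinite ι₂
  apply Set.Subset.antisymm
  · intro Q hQ
    rw [mem_closure_iff_forall_eval] at hQ
    have hrange : Q.rep ∈ LinearMap.range j := by
      by_contra hQr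
      obtain ⟨ℓ, hℓQ, hℓ⟩ := Submodule.exists_le_ker_of_notMem hQr
      let F := linearPullback (LinearMap.pi fun _ : Unit => ℓ) (MvPolynomial.X ())
      refine hℓQ ?_
      have h := hQ F 1 (isHomogeneous_linearPullback _ (MvPolynomial.isHomogeneous_X 𝕜 ())) ?_
      · simpa [F, eval_linearPullback] using h
      · rintro _ ⟨P, -, rfl⟩
        induction P using Projectivization.ind with
        | h x hx =>
        rw [Projectivization.map_mk, eval_rep_mk_eq_zero_iff
          (isHomogeneous_linearPullback _ (MvPolynomial.isHomogeneous_X 𝕜 ())), eval_linearPullback]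
        simpa using hℓ (LinearMap.mem_range_self j x)
    obtain ⟨x, hx⟩ := hrange
    have hx0 : x ≠ 0 := by
      rintro rfl
      exact Q.rep_nonzero (by rw [← hx, map_zero])
    obtain ⟨r, hr⟩ := j.exists_leftInverse_of_injective (LinearMap.ker_eq_bot.mpr hj)
    have hrj : ∀ z, r (j z) = z := fun z => LinearMap.congr_fun hr z
    refine ⟨Projectivization.mk 𝕜 x hx0, ?_, ?_⟩
    · rw [mem_closure_iff_forall_eval]
      intro G d hG hS
      rw [eval_rep_mk_eq_zero_iff hG]
      have h := hQ (linearPullback r G) d (isHomogeneous_linearPullback r hG) ?_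
      · rwa [eval_linearPullback, ← hx, hrj] at h
      · rintro _ ⟨P, hP, rfl⟩
        have hPG := hS P hP
        induction P using Projectivization.ind with
        | h z hz =>
        rw [eval_rep_mk_eq_zero_iff hG] at hPG
        rw [Projectivization.map_mk, eval_rep_mk_eq_zero_iff (isHomogeneous_linearPullback r hG),
          eval_linearPullback, hrj, hPG]
    · rw [Projectivization.map_mk]
      conv_rhs => rw [← Q.mk_rep]
      simp only [hx]
  · rintro _ ⟨P, hP, rfl⟩
    rw [mem_closure_iff_forall_eval] at hP ⊢
    intro F d hF hS
    have h := hP (linearPullback j F) d (isHomogeneous_linearPullback j hF) ?_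
    · induction P using Projectivization.ind with
      | h z hz =>
      rw [eval_rep_mk_eq_zero_iff (isHomogeneous_linearPullback j hF), eval_linearPullback] at h
      rwa [Projectivization.map_mk, eval_rep_mk_eq_zero_iff hF]
    · intro Q hQ
      have h := hS _ ⟨Q, hQ, rfl⟩
      induction Q using Projectivization.ind with
      | h z hz =>
      rw [Projectivization.map_mk, eval_rep_mk_eq_zero_iff hF] at h
      rwa [eval_rep_mk_eq_zero_iff (isHomogeneous_linearPullback j hF), eval_linearPullback]

theorem ProjectivelyEquivalent.symm {X₁ : Set (ℙ 𝕜 (ι₁ → 𝕜))} {X₂ : Set (ℙ 𝕜 (ι₂ → 𝕜))}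
    (h : ProjectivelyEquivalent X₁ X₂) : ProjectivelyEquivalent X₂ X₁ := by
  obtain ⟨N, j₁, h₁, j₂, h₂, h⟩ := h
  exact ⟨N, j₂, h₂, j₁, h₁, h.symm⟩

theorem projectivelyEquivalent_of_map [Fintype ι₂] [Nonempty ι₂] (j : (ι₁ → 𝕜) →ₗ[𝕜] (ι₂ → 𝕜))
    (hj : Function.Injective j) {X₁ : Set (ℙ 𝕜 (ι₁ → 𝕜))} {X₂ : Set (ℙ 𝕜 (ι₂ → 𝕜))}
    (h : Projectivization.map j hj '' X₁ = X₂) : ProjectivelyEquivalent X₁ X₂ := by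
  -- The ambient space in `ProjectivelyEquivalent` has coordinates in `Fin (N + 1)`, so the number
  -- of coordinates must be positive.
  have hcard : Fintype.card ι₂ = (Fintype.card ι₂ - 1) + 1 :=
    (Nat.sub_add_cancel Fintype.card_pos).symm
  let e := (Fintype.equivFin ι₂).trans (finCongr hcard)
  let E : (ι₂ → 𝕜) ≃ₗ[𝕜] (Fin (Fintype.card ι₂ - 1 + 1) → 𝕜) := LinearEquiv.funCongrLeft 𝕜 𝕜 e.symm
  refine ⟨Fintype.card ι₂ - 1, E.toLinearMap ∘ₗ j, E.injective.comp hj, E.toLinearMap,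
    E.injective, ?_⟩
  rw [← h, Set.image_image]
  refine Set.image_congr fun P _ => ?_
  induction P using Projectivization.ind with
  | h z hz => simp only [Projectivization.map_mk, LinearMap.comp_apply]

end ZariskiTopology

/-! ### Irreducible components from a finite family of irreducible sets. -/

section IrreducibleComponents

variable {X : Type*} [TopologicalSpace X]

/-- If `F` lies between a finite union of irreducible sets `D k` and its closure, and no `D l`
lies in the closure of another `D k`, then the closures of the `D k` in `F` are the irreducible
components of `F`. -/
theorem irreducibleComponents_eq_range {κ : Type*} [Finite κ] {F : Set X} {D : κ → Set X}
    (hD : ∀ k, IsIrreducible (D k)) (hDF : ∀ k, D k ⊆ F) (hF : F ⊆ ⋃ k, closure (D k))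
    (hne : ∀ k l, D l ⊆ closure (D k) → k = l) :
    irreducibleComponents F = Set.range fun k => (Subtype.val ⁻¹' closure (D k) : Set F) := by
  have himg : ∀ k, Subtype.val '' (Subtype.val ⁻¹' D k : Set F) = D k := fun k => by
    rw [Subtype.image_preimage_coe, Set.inter_eq_right.mpr (hDF k)]
  have hcl : ∀ k, (Subtype.val ⁻¹' closure (D k) : Set F) =
      closure (Subtype.val ⁻¹' D k : Set F) := fun k => by
    rw [Topology.IsInducing.subtypeVal.closure_eq_preimage_closure_image, himg]
  have hirr : ∀ k, IsIrreducible (Subtype.val ⁻¹' closure (D k) : Set F) := fun k => by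
    rw [hcl]
    refine IsIrreducible.closure ?_
    refine ⟨?_, ?_⟩
    · obtain ⟨x, hx⟩ := (hD k).nonempty
      exact ⟨⟨x, hDF k hx⟩, hx⟩
    · rintro _ _ ⟨U, hU, rfl⟩ ⟨V, hV, rfl⟩ ⟨x, hx, hxU⟩ ⟨y, hy, hyV⟩
      obtain ⟨z, hz, hzUV⟩ := (hD k).2 U V hU hV ⟨x, hx, hxU⟩ ⟨y, hy, hyV⟩
      exact ⟨⟨z, hDF k hz⟩, hz, hzUV⟩
  have hclosed : ∀ k, IsClosed (Subtype.val ⁻¹' closure (D k) : Set F) := fun k =>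
    isClosed_closure.preimage continuous_subtype_val
  have hcover : ∀ C : Set F, IsIrreducible C →
      ∃ k, C ⊆ (Subtype.val ⁻¹' closure (D k) : Set F) := by
    intro C hC
    have := Fintype.ofFinite κ
    classical
    obtain ⟨Z, hZ, hCZ⟩ := isIrreducible_iff_sUnion_isClosed.mp hC
      (Finset.univ.image fun k => (Subtype.val ⁻¹' closure (D k) : Set F))
      (by simp only [Finset.mem_image]; rintro _ ⟨k, -, rfl⟩; exact hclosed k)
      (by
        intro x _
        obtain ⟨k, hk⟩ := Set.mem_iUnion.mp (hF x.2)
        exact ⟨_, by simp only [Finset.coe_image]; exact ⟨k, by simp, rfl⟩, hk⟩)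
    obtain ⟨k, -, rfl⟩ := Finset.mem_image.mp hZ
    exact ⟨k, hCZ⟩
  have hle : ∀ k l, (Subtype.val ⁻¹' closure (D l) : Set F) ⊆ Subtype.val ⁻¹' closure (D k) →
      k = l := fun k l h => hne k l fun x hx => h (a := ⟨x, hDF l hx⟩) (subset_closure hx)
  rw [irreducibleComponents_eq_maximals_closed]
  ext C
  rw [Set.mem_ofPred]
  constructor
  · intro hC
    obtain ⟨k, hk⟩ := hcover C hC.prop.2
    exact ⟨k, (hC.eq_of_le ⟨hclosed k, hirr k⟩ hk).symm⟩
  · rintro ⟨k, rfl⟩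
    refine ⟨⟨hclosed k, hirr k⟩, fun C hC hle' => ?_⟩
    obtain ⟨l, hl⟩ := hcover C hC.2
    obtain rfl := hle l k (hle'.trans hl)
    exact hl

theorem encard_irreducibleComponents {κ : Type*} [Fintype κ] {F : Set X} {D : κ → Set X}
    (hD : ∀ k, IsIrreducible (D k)) (hDF : ∀ k, D k ⊆ F) (hF : F ⊆ ⋃ k, closure (D k))
    (hne : ∀ k l, D l ⊆ closure (D k) → k = l) :
    (irreducibleComponents F).encard = Fintype.card κ := by
  rw [irreducibleComponents_eq_range hD hDF hF hne, ← Set.image_univ,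
    Function.Injective.encard_image, Set.encard_univ, ENat.card_eq_coe_fintype_card]
  intro k l hkl
  exact hne k l fun x hx => by
    have : (⟨x, hDF l hx⟩ : F) ∈ (Subtype.val ⁻¹' closure (D l) : Set F) := subset_closure hx
    dsimp only at hkl
    rwa [← hkl] at this

theorem closure_image_of_mem_irreducibleComponents {κ : Type*} [Finite κ] {F : Set X}
    {D : κ → Set X} (hD : ∀ k, IsIrreducible (D k)) (hDF : ∀ k, D k ⊆ F)
    (hF : F ⊆ ⋃ k, closure (D k)) (hne : ∀ k l, D l ⊆ closure (D k) → k = l)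
    {C : Set F} (hC : C ∈ irreducibleComponents F) :
    ∃ k, closure (Subtype.val '' C : Set X) = closure (D k) := by
  rw [irreducibleComponents_eq_range hD hDF hF hne] at hC
  obtain ⟨k, rfl⟩ := hC
  refine ⟨k, Set.Subset.antisymm (closure_minimal ?_ isClosed_closure) (closure_mono ?_)⟩
  · rintro _ ⟨x, hx, rfl⟩
    exact hx
  · intro x hx
    exact ⟨⟨x, hDF k hx⟩, subset_closure hx, rfl⟩

end IrreducibleComponents

/-! ### Linear independence of characters. -/

section Characters

/-- A relation between characters `χ a` remains valid if the values of the characters are replaced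
by any quantities that depend only on the character. -/
theorem sum_mul_eq_zero_of_sum_characters_eq_zero {𝕜 H α : Type*} [Field 𝕜] [Monoid H]
    (s : Finset α) (χ : α → H →* 𝕜) (c f : α → 𝕜) (h : ∀ x, ∑ a ∈ s, c a * χ a x = 0)
    (hf : ∀ a ∈ s, ∀ b ∈ s, χ a = χ b → f a = f b) : ∑ a ∈ s, c a * f a = 0 := by
  classical
  have hmaps : ∀ a ∈ s, χ a ∈ s.image χ := fun a ha => Finset.mem_image_of_mem χ ha
  -- By independence of distinct characters, the coefficients belonging to one and the same
  -- character add up to zero.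
  have hzero : ∀ η ∈ s.image χ, ∑ a ∈ s with χ a = η, c a = 0 := by
    refine linearIndependent_iff'.mp (linearIndependent_monoidHom H 𝕜) (s.image χ)
      (fun η => ∑ a ∈ s with χ a = η, c a) ?_
    funext x
    rw [Finset.sum_apply, Pi.zero_apply, ← h x, ← Finset.sum_fiberwise_of_maps_to hmaps]
    refine Finset.sum_congr rfl fun η _ => ?_
    rw [Pi.smul_apply, smul_eq_mul, Finset.sum_mul]
    refine Finset.sum_congr rfl fun a ha => ?_
    rw [(Finset.mem_filter.mp ha).2]
  rw [← Finset.sum_fiberwise_of_maps_to hmaps]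
  refine Finset.sum_eq_zero fun η hη => ?_
  obtain ⟨b, hb, rfl⟩ := Finset.mem_image.mp hη
  have : ∑ a ∈ s with χ a = χ b, c a * f a = (∑ a ∈ s with χ a = χ b, c a) * f b := by
    rw [Finset.sum_mul]
    refine Finset.sum_congr rfl fun a ha => ?_
    rw [Finset.mem_filter] at ha
    rw [hf a ha.1 b hb ha.2]
  rw [this, hzero _ hη, zero_mul]

end Characters

/-! ### Points of tori, their characters, and irreducibility of monomial images. -/

section Torus

variable {𝕜 : Type*} [Field 𝕜] {M : Type*} [AddCommGroup M] {ι : Type*}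

theorem monomialValue_ne_zero (t : Torus 𝕜 M) (u : M) : monomialValue t u ≠ 0 := Units.ne_zero _

@[simp] theorem monomialValue_zero (t : Torus 𝕜 M) : monomialValue t 0 = 1 := by
  simp [monomialValue]

theorem monomialValue_add (t : Torus 𝕜 M) (u v : M) :
    monomialValue t (u + v) = monomialValue t u * monomialValue t v := by
  simp [monomialValue, ofAdd_add]

theorem monomialValue_neg (t : Torus 𝕜 M) (u : M) :
    monomialValue t (-u) = (monomialValue t u)⁻¹ := by
  simp [monomialValue]

theorem monomialValue_sub (t : Torus 𝕜 M) (u v : M) :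
    monomialValue t (u - v) = monomialValue t u * (monomialValue t v)⁻¹ := by
  rw [sub_eq_add_neg, monomialValue_add, monomialValue_neg]

theorem monomialValue_nsmul (t : Torus 𝕜 M) (k : ℕ) (u : M) :
    monomialValue t (k • u) = monomialValue t u ^ k := by
  simp [monomialValue, ofAdd_nsmul]

theorem monomialValue_zsmul (t : Torus 𝕜 M) (k : ℤ) (u : M) :
    monomialValue t (k • u) = monomialValue t u ^ k := by
  simp [monomialValue, ofAdd_zsmul]

@[simp] theorem monomialValue_one (u : M) : monomialValue (1 : Torus 𝕜 M) u = 1 := by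
  simp [monomialValue]

@[simp] theorem monomialValue_mul (s t : Torus 𝕜 M) (u : M) :
    monomialValue (s * t) u = monomialValue s u * monomialValue t u := by
  simp [monomialValue]

@[simp] theorem monomialValue_inv (s : Torus 𝕜 M) (u : M) :
    monomialValue s⁻¹ u = (monomialValue s u)⁻¹ := by
  simp [monomialValue]

theorem torus_ext {s t : Torus 𝕜 M} (h : ∀ u, monomialValue s u = monomialValue t u) : s = t :=
  MonoidHom.ext fun u => Units.ext (h u.toAdd)

/-- The evaluation of points of the torus at `u`, as a character of the torus. -/
def torusCharacter (𝕜 : Type*) [Field 𝕜] (u : M) : Torus 𝕜 M →* 𝕜 where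
  toFun t := monomialValue t u
  map_one' := monomialValue_one u
  map_mul' s t := monomialValue_mul s t u

/-- The point of the torus of `M` induced by a homomorphism `M → N` and a point of the torus
of `N`. -/
def Torus.comap {N : Type*} [AddCommGroup N] (f : M →+ N) (t : Torus 𝕜 N) : Torus 𝕜 M :=
  t.comp f.toMultiplicative

@[simp] theorem monomialValue_comap {N : Type*} [AddCommGroup N] (f : M →+ N) (t : Torus 𝕜 N)
    (u : M) : monomialValue (t.comap f) u = monomialValue t (f u) := rfl

/-- A point of the torus with prescribed coordinates with respect to a basis. -/
theorem exists_torus_basis {β : Type*} (b : Module.Basis β ℤ M) (z : β → 𝕜ˣ) :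
    ∃ t : Torus 𝕜 M, ∀ i, monomialValue t (b i) = z i := by
  let f : M →ₗ[ℤ] Additive 𝕜ˣ := b.constr ℤ fun i => Additive.ofMul (z i)
  refine ⟨AddMonoidHom.toMultiplicativeLeft f.toAddMonoidHom, fun i => ?_⟩
  have : f (b i) = Additive.ofMul (z i) := b.constr_basis ℤ _ i
  change ((f (b i)).toMul : 𝕜) = z i
  rw [this]
  rfl

theorem exists_units_zpow_ne_one [Infinite 𝕜] {k : ℤ} (hk : k ≠ 0) : ∃ z : 𝕜ˣ, z ^ k ≠ 1 := by
  have hk' : 0 < k.natAbs := Int.natAbs_pos.mpr hk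
  -- The factor `X` excludes the root 0, so that a non-root is a unit.
  have hp : ((Polynomial.X ^ k.natAbs - 1) * Polynomial.X : Polynomial 𝕜) ≠ 0 :=
    mul_ne_zero (Polynomial.X_pow_sub_C_ne_zero hk' 1) Polynomial.X_ne_zero
  obtain ⟨z, hz⟩ : ∃ z : 𝕜, ¬ ((Polynomial.X ^ k.natAbs - 1) * Polynomial.X : Polynomial 𝕜).IsRoot z := by
    by_contra! h
    exact hp (Polynomial.funext fun z => by simpa using h z)
  simp only [Polynomial.IsRoot, Polynomial.eval_mul, Polynomial.eval_sub, Polynomial.eval_pow,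
    Polynomial.eval_X, Polynomial.eval_one, mul_eq_zero, not_or] at hz
  refine ⟨Units.mk0 z hz.2, fun h => hz.1 ?_⟩
  have h' : (Units.mk0 z hz.2) ^ k.natAbs = 1 := pow_natAbs_eq_one.mpr h
  rw [sub_eq_zero]
  simpa using congrArg Units.val h'

/-- If u and v differ in the i-th coordinate, the one-parameter subgroup dual to that coordinate
distinguishes them at a scalar z with `z ^ k ≠ 1`, where k is the difference of the coordinates. -/
theorem torusCharacter_injective [Infinite 𝕜] [Module.Free ℤ M] :
    Function.Injective (torusCharacter 𝕜 : M → Torus 𝕜 M →* 𝕜) := by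
  intro u v huv
  let b := Module.Free.chooseBasis ℤ M
  by_contra hne
  obtain ⟨i, hi⟩ : ∃ i, b.repr (u - v) i ≠ 0 := by
    by_contra! h
    exact hne (sub_eq_zero.mp (b.repr.map_eq_zero_iff.mp (Finsupp.ext h)))
  obtain ⟨z, hz⟩ := exists_units_zpow_ne_one (𝕜 := 𝕜) hi
  apply hz
  let t : Torus 𝕜 M := Torus.comap (b.coord i).toAddMonoidHom (zpowersHom 𝕜ˣ z)
  have ht : ∀ w, monomialValue t w = (z : 𝕜) ^ (b.repr w i) := fun w => by
    simp [t, monomialValue, Torus.comap]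
  have h : monomialValue t u = monomialValue t v := DFunLike.congr_fun huv t
  rw [ht, ht] at h
  apply Units.ext
  rw [map_sub, Finsupp.sub_apply, Units.val_zpow_eq_zpow_val, zpow_sub₀ z.ne_zero, h,
    Units.val_one, div_self (zpow_ne_zero _ z.ne_zero)]

/-- The vector of the values of the monomials `z^{u i}` at a point of the torus. -/
def torusPoint (u : ι → M) (t : Torus 𝕜 M) : ι → 𝕜 := fun i => monomialValue t (u i)

@[simp] theorem torusPoint_apply (u : ι → M) (t : Torus 𝕜 M) (i : ι) :
    torusPoint u t i = monomialValue t (u i) := rfl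

theorem torusPoint_ne_zero [Nonempty ι] (u : ι → M) (t : Torus 𝕜 M) : torusPoint u t ≠ 0 :=
  fun h => monomialValue_ne_zero t _ (congrFun h (Classical.arbitrary ι))

theorem prod_torusPoint_pow (u : ι → M) (t : Torus 𝕜 M) (m : ι →₀ ℕ) :
    (m.prod fun i k => torusPoint u t i ^ k) = monomialValue t (Finsupp.weight u m) := by
  induction m using Finsupp.induction_linear with
  | zero => simp
  | add f g hf hg =>
    rw [Finsupp.prod_add_index' (by simp) (by intros; rw [pow_add]), hf, hg, map_add,
      monomialValue_add]
  | single i k =>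
    rw [Finsupp.prod_single_index (by simp), Finsupp.weight_single, monomialValue_nsmul]
    rfl

theorem eval_eq_sum_prod (x : ι → 𝕜) (F : MvPolynomial ι 𝕜) :
    MvPolynomial.eval x F = ∑ m ∈ F.support, F.coeff m * m.prod fun i k => x i ^ k := by
  rw [MvPolynomial.eval_eq]
  rfl

theorem eval_torusPoint (u : ι → M) (t : Torus 𝕜 M) (F : MvPolynomial ι 𝕜) :
    MvPolynomial.eval (torusPoint u t) F =
      ∑ m ∈ F.support, F.coeff m * torusCharacter 𝕜 (Finsupp.weight u m) t := by
  rw [eval_eq_sum_prod]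
  simp only [prod_torusPoint_pow]
  rfl

theorem uniqueSums_of_free [Module.Free ℤ M] : UniqueSums M :=
  UniqueSums.of_injective_addHom
    (Module.Free.chooseBasis ℤ M).repr.toAddEquiv.toAddMonoidHom.toAddHom
    (Module.Free.chooseBasis ℤ M).repr.injective inferInstance

/-- The polynomial functions on (a multiplicative translate of) the image of a torus under a
monomial map form an integral domain. -/
theorem eval_smul_torusPoint_mul_eq_zero [Infinite 𝕜] [Module.Free ℤ M] (u : ι → M) (a : ι → 𝕜)
    {F G : MvPolynomial ι 𝕜} (h : ∀ t : Torus 𝕜 M, MvPolynomial.eval (a * torusPoint u t) F *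
      MvPolynomial.eval (a * torusPoint u t) G = 0) :
    (∀ t : Torus 𝕜 M, MvPolynomial.eval (a * torusPoint u t) F = 0) ∨
      ∀ t : Torus 𝕜 M, MvPolynomial.eval (a * torusPoint u t) G = 0 := by
  have := uniqueSums_of_free (M := M)
  -- Evaluation at torus points factors through the group algebra of M. The latter is a domain
  -- because M has unique sums, and its elements are determined by their values on the torus because
  -- distinct exponents give distinct characters.
  let θ : MvPolynomial ι 𝕜 →ₐ[𝕜] AddMonoidAlgebra 𝕜 M :=
    MvPolynomial.aeval fun i => AddMonoidAlgebra.single (u i) (a i)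
  let ev (t : Torus 𝕜 M) : AddMonoidAlgebra 𝕜 M →ₐ[𝕜] 𝕜 :=
    AddMonoidAlgebra.lift 𝕜 𝕜 M ((Units.coeHom 𝕜).comp t)
  have hev : ∀ t F, ev t (θ F) = MvPolynomial.eval (a * torusPoint u t) F := by
    intro t F
    have : (ev t).comp θ = MvPolynomial.aeval (a * torusPoint u t) := by
      ext i
      simp [θ, ev, monomialValue]
    exact DFunLike.congr_fun this F
  have hinj : ∀ f : AddMonoidAlgebra 𝕜 M, (∀ t, ev t f = 0) → f = 0 := by
    intro f hf
    ext v
    by_contra hv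
    classical
    have hsum : ∀ t : Torus 𝕜 M, ∑ w ∈ f.coeff.support, f.coeff w * torusCharacter 𝕜 w t = 0 := by
      intro t
      rw [← hf t, AddMonoidAlgebra.lift_apply]
      simp [Finsupp.sum, torusCharacter, monomialValue]
    have h1 := sum_mul_eq_zero_of_sum_characters_eq_zero f.coeff.support (torusCharacter 𝕜)
      f.coeff (fun w => if w = v then 1 else 0) hsum
      (fun w _ w' _ hww' => by rw [torusCharacter_injective hww'])
    simp only [mul_ite, mul_one, mul_zero, Finset.sum_ite_eq', Finsupp.mem_support_iff] at h1
    exact hv (by simpa using h1)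
  have hmul : θ F * θ G = 0 := hinj _ fun t => by rw [map_mul, hev, hev, h t]
  rcases mul_eq_zero.mp hmul with h0 | h0
  · left; intro t; rw [← hev, h0, map_zero]
  · right; intro t; rw [← hev, h0, map_zero]

theorem isIrreducible_range_mk_torusPoint [Infinite 𝕜] [Module.Free ℤ M] (u : ι → M) (a : ι → 𝕜)
    (ha : ∀ t : Torus 𝕜 M, a * torusPoint u t ≠ 0) :
    IsIrreducible (Set.range fun t : Torus 𝕜 M =>
      Projectivization.mk 𝕜 (a * torusPoint u t) (ha t)) := by
  refine ⟨⟨_, 1, rfl⟩, ?_⟩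
  rw [isPreirreducible_iff_isClosed_union_isClosed]
  intro Z₁ Z₂ hZ₁ hZ₂ hZ
  obtain ⟨S₁, hS₁, rfl⟩ := isClosed_iff_isZariskiClosed.mp hZ₁
  obtain ⟨S₂, hS₂, rfl⟩ := isClosed_iff_isZariskiClosed.mp hZ₂
  by_contra! hcon
  simp only [Set.not_subset, Set.mem_range, exists_exists_eq_and, projZeroLocus,
    Set.mem_ofPred, not_forall] at hcon
  obtain ⟨⟨t₁, F, hF, hFt⟩, ⟨t₂, G, hG, hGt⟩⟩ := hcon
  obtain ⟨d, hd⟩ := hS₁ F hF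
  obtain ⟨e, he⟩ := hS₂ G hG
  rw [eval_rep_mk_eq_zero_iff hd] at hFt
  rw [eval_rep_mk_eq_zero_iff he] at hGt
  have hprod (t : Torus 𝕜 M) : MvPolynomial.eval (a * torusPoint u t) F *
      MvPolynomial.eval (a * torusPoint u t) G = 0 := by
    rcases hZ ⟨t, rfl⟩ with h | h
    · rw [(eval_rep_mk_eq_zero_iff hd _ _).mp (h F hF), zero_mul]
    · rw [(eval_rep_mk_eq_zero_iff he _ _).mp (h G hG), mul_zero]
  rcases eval_smul_torusPoint_mul_eq_zero u a hprod with h | h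
  · exact hFt (h t₁)
  · exact hGt (h t₂)

end Torus

/-! ### Ideals of projective monomial varieties and Euler relations. -/

section MonomialVariety

variable {𝕜 : Type*} [Field 𝕜] {M : Type*} [AddCommGroup M] {ι : Type*}

/-- The image of the torus of `M` in projective space under the monomials `z^{u i}`. -/
def monomialImage (𝕜 : Type*) [Field 𝕜] (u : ι → M) : Set (ℙ 𝕜 (ι → 𝕜)) :=
  {P | ∃ (t : Torus 𝕜 M) (h : torusPoint u t ≠ 0), P = Projectivization.mk 𝕜 (torusPoint u t) h}

theorem monomialValue_sum {α : Type*} (t : Torus 𝕜 M) (s : Finset α) (f : α → M) :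
    monomialValue t (∑ a ∈ s, f a) = ∏ a ∈ s, monomialValue t (f a) := by
  classical
  induction s using Finset.induction_on with
  | empty => simp
  | insert a s ha ih => rw [Finset.sum_insert ha, Finset.prod_insert ha, monomialValue_add, ih]

/-- The exponents `(u i, 1)` of the affine cone over a projective monomial parametrization. -/
def coneExponent (u : ι → M) : ι → M × ℤ := fun i => (u i, 1)

theorem torusPoint_coneExponent (u : ι → M) (t : Torus 𝕜 (M × ℤ)) :
    torusPoint (coneExponent u) t =
      monomialValue t (0, 1) • torusPoint u (t.comap (AddMonoidHom.inl M ℤ)) := by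
  funext i
  simp only [torusPoint_apply, coneExponent, Pi.smul_apply, smul_eq_mul, monomialValue_comap]
  rw [← monomialValue_add]
  simp

theorem torusPoint_coneExponent_comap (u : ι → M) (t : Torus 𝕜 M) :
    torusPoint (coneExponent u) (t.comap (AddMonoidHom.fst M ℤ)) = torusPoint u t := by
  funext i
  simp [coneExponent]

/-- The ℤ-component of the weight of a monomial is its degree, so monomials of different degrees
give different characters of the torus of M × ℤ and cannot cancel. -/
theorem eval_homogeneousComponent_eq_zero [Infinite 𝕜] [Module.Free ℤ M] (u : ι → M)
    {F : MvPolynomial ι 𝕜}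
    (hF : ∀ t : Torus 𝕜 (M × ℤ), MvPolynomial.eval (torusPoint (coneExponent u) t) F = 0) (d : ℕ)
    (t : Torus 𝕜 (M × ℤ)) :
    MvPolynomial.eval (torusPoint (coneExponent u) t)
      (MvPolynomial.homogeneousComponent d F) = 0 := by
  have hdeg : ∀ m : ι →₀ ℕ, (Finsupp.weight (coneExponent u) m).2 = m.degree := by
    intro m
    induction m using Finsupp.induction_linear with
    | zero => simp
    | add f g hf hg => simp [hf, hg]
    | single i k =>
      rw [Finsupp.weight_single, Finsupp.degree_single]
      simp [coneExponent]
  have h := sum_mul_eq_zero_of_sum_characters_eq_zero F.support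
    (fun m => torusCharacter 𝕜 (Finsupp.weight (coneExponent u) m)) (fun m => F.coeff m)
    (fun m => if m.degree = d then torusCharacter 𝕜 (Finsupp.weight (coneExponent u) m) t else 0)
    (fun t => by rw [← hF t, eval_torusPoint]) (fun m _ m' _ hmm' => by
      have h1 := torusCharacter_injective hmm'
      have h2 : m.degree = m'.degree := by
        have := congrArg Prod.snd h1
        rw [hdeg, hdeg] at this
        exact_mod_cast this
      simp only [h1, h2])
  rw [MvPolynomial.homogeneousComponent_apply, map_sum, ← h, Finset.sum_filter]
  refine Finset.sum_congr rfl fun m _ => ?_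
  split_ifs with hm
  · rw [MvPolynomial.eval_monomial, prod_torusPoint_pow]
    rfl
  · simp

theorem rep_mem_affineCone {X : Set (ℙ 𝕜 (ι → 𝕜))} {P : ℙ 𝕜 (ι → 𝕜)} (hP : P ∈ X) :
    P.rep ∈ affineCone X := fun hx => by rwa [Projectivization.mk_rep]

theorem mem_idealOf_iff {X : Set (ℙ 𝕜 (ι → 𝕜))} {F : MvPolynomial ι 𝕜} :
    F ∈ idealOf X ↔ ∀ x ∈ affineCone X, MvPolynomial.eval x F = 0 := by
  rw [idealOf, MvPolynomial.mem_vanishingIdeal_iff]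
  rfl

/-- The torus of M × ℤ parametrizes the cone over the torus image. This replaces the closure by a
parametrized set, on which membership in the ideal is a question about characters. -/
theorem mem_idealOf_closure_monomialImage [Infinite 𝕜] [Module.Free ℤ M] [Nonempty ι]
    {u : ι → M} {F : MvPolynomial ι 𝕜} :
    F ∈ idealOf (closure (monomialImage 𝕜 u)) ↔
      ∀ t : Torus 𝕜 (M × ℤ), MvPolynomial.eval (torusPoint (coneExponent u) t) F = 0 := by
  rw [mem_idealOf_iff]
  constructor
  · intro h t
    refine h _ fun hx => subset_closure ?_
    refine ⟨t.comap (AddMonoidHom.inl M ℤ), torusPoint_ne_zero _ _, ?_⟩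
    rw [Projectivization.mk_eq_mk_iff']
    exact ⟨monomialValue t (0, 1), (torusPoint_coneExponent u t).symm⟩
  · intro h x hx
    have hcomp : ∀ d (t : Torus 𝕜 M), MvPolynomial.eval (torusPoint u t)
        (MvPolynomial.homogeneousComponent d F) = 0 := fun d t => by
      rw [← torusPoint_coneExponent_comap]
      exact eval_homogeneousComponent_eq_zero u h d _
    rw [← MvPolynomial.sum_homogeneousComponent F, map_sum]
    refine Finset.sum_eq_zero fun d _ => ?_
    have hd := MvPolynomial.homogeneousComponent_isHomogeneous d F
    by_cases hx0 : x = 0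
    · subst hx0
      have h0 := eval_smul_of_isHomogeneous hd 0 (torusPoint u (1 : Torus 𝕜 M))
      rwa [hcomp, mul_zero, zero_smul] at h0
    · rw [← eval_rep_mk_eq_zero_iff hd x hx0]
      refine mem_closure_iff_forall_eval.mp (hx hx0) _ d hd ?_
      rintro _ ⟨t, ht, rfl⟩
      rw [eval_rep_mk_eq_zero_iff hd, hcomp]

theorem isPrime_idealOf_closure_monomialImage [Infinite 𝕜] [Module.Free ℤ M] [Nonempty ι]
    (u : ι → M) : (idealOf (closure (monomialImage 𝕜 u))).IsPrime := by
  refine ⟨fun h => ?_, fun {F G} h => ?_⟩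
  · have h1 := (Ideal.eq_top_iff_one _).mp h
    simpa using mem_idealOf_closure_monomialImage.mp h1 1
  · rw [mem_idealOf_closure_monomialImage] at h ⊢
    rw [mem_idealOf_closure_monomialImage]
    simpa using eval_smul_torusPoint_mul_eq_zero (coneExponent u) (1 : ι → 𝕜) (F := F) (G := G)
      fun t => by simpa using h t

/-- The Euler relation for the grading by `ℓ (u i)`. -/
theorem weighted_euler [Infinite 𝕜] [Module.Free ℤ M] [Fintype ι] (u : ι → M) (ℓ : M →+ 𝕜)
    {F : MvPolynomial ι 𝕜} (hF : ∀ t : Torus 𝕜 M, MvPolynomial.eval (torusPoint u t) F = 0)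
    (t : Torus 𝕜 M) :
    ∑ i, ℓ (u i) * (torusPoint u t i *
      MvPolynomial.eval (torusPoint u t) (MvPolynomial.pderiv i F)) = 0 := by
  have hwt : ∀ m : ι →₀ ℕ, ∑ i, ℓ (u i) * (m i : 𝕜) = ℓ (Finsupp.weight u m) := by
    intro m
    rw [Finsupp.weight_apply, Finsupp.sum_fintype _ _ (by simp), map_sum]
    refine Finset.sum_congr rfl fun i _ => ?_
    rw [map_nsmul, nsmul_eq_mul, mul_comm]
  have key : ∀ i, torusPoint u t i *
      MvPolynomial.eval (torusPoint u t) (MvPolynomial.pderiv i F) =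
      ∑ m ∈ F.support, F.coeff m * ((m i : 𝕜) * torusCharacter 𝕜 (Finsupp.weight u m) t) := by
    intro i
    have h1 : torusPoint u t i * MvPolynomial.eval (torusPoint u t) (MvPolynomial.pderiv i F) =
        MvPolynomial.eval (torusPoint u t) (MvPolynomial.X i * MvPolynomial.pderiv i F) := by
      simp
    rw [h1]
    conv_lhs => rw [F.as_sum, map_sum, Finset.mul_sum, map_sum]
    refine Finset.sum_congr rfl fun m _ => ?_
    rw [MvPolynomial.X_mul_pderiv_monomial, map_nsmul, MvPolynomial.eval_monomial,
      prod_torusPoint_pow, nsmul_eq_mul]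
    change _ = _ * (_ * monomialValue t _)
    ring
  -- The vanishing of F is a relation between the characters of weight `Finsupp.weight u m`. The
  -- quantity ℓ(weight) times the value at t depends only on the character, so it may replace it.
  have h := sum_mul_eq_zero_of_sum_characters_eq_zero F.support
    (fun m => torusCharacter 𝕜 (Finsupp.weight u m)) (fun m => F.coeff m)
    (fun m => ℓ (Finsupp.weight u m) * torusCharacter 𝕜 (Finsupp.weight u m) t)
    (fun t => by rw [← hF t, eval_torusPoint]) (fun m _ m' _ hmm' => by
      simp only [torusCharacter_injective hmm'])
  rw [← h]
  simp only [key, ← hwt, Finset.mul_sum, Finset.sum_mul]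
  rw [Finset.sum_comm]
  refine Finset.sum_congr rfl fun m _ => Finset.sum_congr rfl fun i _ => ?_
  ring

end MonomialVariety

/-! ### The configuration of the e_i and p w_j, and equations of its variety. -/

/-- Exponents `u i` in `ℤ^n` consisting of the standard basis vectors and of vectors `p • w j`,
one of which is `0`. -/
structure GaussConfig (p n : ℕ) (ι κ : Type*) where
  /-- the exponents -/
  u : ι → Fin n → ℤ
  /-- the numbering of the exponents -/
  σ : Fin n ⊕ κ ≃ ι
  /-- the exponents `p • w j` that are not basis vectors, divided by `p` -/
  w : κ → Fin n → ℤ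
  /-- the number of the exponent `0` -/
  o : κ
  u_inl : ∀ i, u (σ (Sum.inl i)) = Pi.single i 1
  u_inr : ∀ j, u (σ (Sum.inr j)) = p • w j
  w_o : w o = 0

namespace GaussConfig

variable {p n : ℕ} {ι κ : Type*} (C : GaussConfig p n ι κ) (𝕜 : Type*) [Field 𝕜]

theorem nonempty (C : GaussConfig p n ι κ) : Nonempty ι := ⟨C.σ (Sum.inr C.o)⟩

/-- The toric variety of the configuration. -/
def variety : Set (ℙ 𝕜 (ι → 𝕜)) := closure (monomialImage 𝕜 C.u)

/-- The points of the affine cone over the torus of `C.variety`. -/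
abbrev conePoint {𝕜 : Type*} [Field 𝕜] (t : Torus 𝕜 ((Fin n → ℤ) × ℤ)) : ι → 𝕜 :=
  torusPoint (coneExponent C.u) t

/-- The coordinates of the basis vectors and of the exponent `0`. -/
def basicIndex : Option (Fin n) → ι := fun a => a.elim (C.σ (Sum.inr C.o)) fun i => C.σ (Sum.inl i)

variable {𝕜}

theorem mem_idealOf_iff [Infinite 𝕜] {F : MvPolynomial ι 𝕜} :
    F ∈ idealOf (C.variety 𝕜) ↔
      ∀ t : Torus 𝕜 ((Fin n → ℤ) × ℤ), MvPolynomial.eval (C.conePoint t) F = 0 :=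
  have := C.nonempty
  mem_idealOf_closure_monomialImage

theorem isPrime_idealOf [Infinite 𝕜] : (idealOf (C.variety 𝕜)).IsPrime :=
  have := C.nonempty
  isPrime_idealOf_closure_monomialImage C.u

theorem conePoint_ne_zero (t : Torus 𝕜 ((Fin n → ℤ) × ℤ)) (i : ι) : C.conePoint t i ≠ 0 :=
  monomialValue_ne_zero _ _

theorem sum_eq [Fintype ι] [Fintype κ] {A : Type*} [AddCommMonoid A] (f : ι → A) :
    ∑ i, f i = ∑ i, f (C.σ (Sum.inl i)) + ∑ j, f (C.σ (Sum.inr j)) := by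
  rw [← C.σ.sum_comp, Fintype.sum_sum_type]

theorem conePoint_inr (t : Torus 𝕜 ((Fin n → ℤ) × ℤ)) (j : κ) :
    C.conePoint t (C.σ (Sum.inr j)) =
      C.conePoint t (C.σ (Sum.inr C.o)) * monomialValue t (C.w j, 0) ^ p := by
  change monomialValue t _ = monomialValue t _ * _
  rw [← monomialValue_nsmul, ← monomialValue_add]
  congr 1
  simp [coneExponent, C.u_inr, C.w_o]

/-- The i-th coordinate modulo p kills every p w_j and every other basis vector, so the
corresponding Euler relation is the single term x_i ∂F/∂x_i; and x_i is nonzero on the torus. -/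
theorem pderiv_inl_mem_idealOf [Infinite 𝕜] [CharP 𝕜 p] [Fintype ι] [Fintype κ]
    {F : MvPolynomial ι 𝕜} (hF : F ∈ idealOf (C.variety 𝕜)) (i : Fin n) :
    MvPolynomial.pderiv (C.σ (Sum.inl i)) F ∈ idealOf (C.variety 𝕜) := by
  rw [C.mem_idealOf_iff] at hF ⊢
  intro t
  let ℓ : (Fin n → ℤ) × ℤ →+ 𝕜 :=
    (Int.castAddHom 𝕜).comp ((Pi.evalAddMonoidHom _ i).comp (AddMonoidHom.fst _ _))
  have h := weighted_euler (coneExponent C.u) ℓ hF t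
  have hℓl : ∀ k, ℓ (coneExponent C.u (C.σ (Sum.inl k))) = if k = i then 1 else 0 := by
    intro k
    simp [ℓ, coneExponent, C.u_inl, Pi.single_apply, eq_comm]
  have hℓr : ∀ j, ℓ (coneExponent C.u (C.σ (Sum.inr j))) = 0 := by
    intro j
    simp [ℓ, coneExponent, C.u_inr]
  rw [C.sum_eq] at h
  simp only [hℓl, hℓr, zero_mul, Finset.sum_const_zero, add_zero, ite_mul, one_mul,
    Finset.sum_ite_eq', Finset.mem_univ, if_true] at h
  exact (mul_eq_zero.mp h).resolve_left (C.conePoint_ne_zero t _)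

/-- This is the Euler relation for the total degree, minus the terms of the x_i, which lie in the
ideal by `pderiv_inl_mem_idealOf`. -/
theorem euler_mem_idealOf [Infinite 𝕜] [CharP 𝕜 p] [Fintype ι] [Fintype κ]
    {F : MvPolynomial ι 𝕜} (hF : F ∈ idealOf (C.variety 𝕜)) :
    ∑ j, MvPolynomial.X (C.σ (Sum.inr j)) * MvPolynomial.pderiv (C.σ (Sum.inr j)) F ∈
      idealOf (C.variety 𝕜) := by
  have hx : ∀ i, MvPolynomial.X (C.σ (Sum.inl i)) * MvPolynomial.pderiv (C.σ (Sum.inl i)) F ∈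
      idealOf (C.variety 𝕜) := fun i => Ideal.mul_mem_left _ _ (C.pderiv_inl_mem_idealOf hF i)
  rw [← Ideal.add_mem_iff_right _ (Ideal.sum_mem _ fun i (_ : i ∈ Finset.univ) => hx i),
    ← C.sum_eq (fun i => MvPolynomial.X i * MvPolynomial.pderiv i F)]
  rw [C.mem_idealOf_iff] at hF ⊢
  intro t
  have h := weighted_euler (coneExponent C.u)
    ((Int.castAddHom 𝕜).comp (AddMonoidHom.snd (Fin n → ℤ) ℤ)) hF t
  simpa [coneExponent] using h

/-- A monomial whose value on the cone is the character `(v, 0)` up to a factor that is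
symmetric in `v` and `-v`. -/
noncomputable def signedMonomial (𝕜 : Type*) [Field 𝕜] (v : Fin n → ℤ) :
    MvPolynomial (Option (Fin n)) 𝕜 :=
  (∏ i, MvPolynomial.X (some i) ^ (v i).toNat) * MvPolynomial.X none ^ ∑ i, (-v i).toNat

theorem eval_signedMonomial (t : Torus 𝕜 ((Fin n → ℤ) × ℤ)) (v : Fin n → ℤ) :
    MvPolynomial.eval (C.conePoint t) (MvPolynomial.rename C.basicIndex (signedMonomial 𝕜 v)) =
      monomialValue t (∑ i, (v i).toNat • (Pi.single i 1, 1) + (∑ i, (-v i).toNat) • (0, 1)) := by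
  rw [MvPolynomial.eval_rename, monomialValue_add, monomialValue_sum, monomialValue_nsmul]
  simp only [monomialValue_nsmul]
  simp [signedMonomial, basicIndex, coneExponent, C.u_inl, C.u_inr, C.w_o]

theorem eval_signedMonomial_eq (t : Torus 𝕜 ((Fin n → ℤ) × ℤ)) (v : Fin n → ℤ) :
    MvPolynomial.eval (C.conePoint t) (MvPolynomial.rename C.basicIndex (signedMonomial 𝕜 v)) =
      monomialValue t (v, 0) * MvPolynomial.eval (C.conePoint t)
        (MvPolynomial.rename C.basicIndex (signedMonomial 𝕜 (-v))) := by
  rw [C.eval_signedMonomial, C.eval_signedMonomial, ← monomialValue_add]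
  congr 1
  refine Prod.ext ?_ ?_
  · funext k
    simp [Prod.fst_sum, Finset.sum_apply, Pi.single_apply]
    omega
  · simp [Prod.snd_sum]
    ring

theorem eval_signedMonomial_ne_zero (t : Torus 𝕜 ((Fin n → ℤ) × ℤ)) (v : Fin n → ℤ) :
    MvPolynomial.eval (C.conePoint t)
      (MvPolynomial.rename C.basicIndex (signedMonomial 𝕜 v)) ≠ 0 := by
  rw [C.eval_signedMonomial]
  exact monomialValue_ne_zero _ _

/-- The binomial `y_j G^p - y_o H^p` in the ideal of the variety, where `G` and `H` do not involve
the variable `y_j`. -/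
noncomputable def binomial (𝕜 : Type*) [Field 𝕜] (j : κ) : MvPolynomial ι 𝕜 :=
  MvPolynomial.X (C.σ (Sum.inr j)) *
      MvPolynomial.rename C.basicIndex (signedMonomial 𝕜 (-C.w j)) ^ p -
    MvPolynomial.X (C.σ (Sum.inr C.o)) *
      MvPolynomial.rename C.basicIndex (signedMonomial 𝕜 (C.w j)) ^ p

theorem binomial_mem_idealOf [Infinite 𝕜] (j : κ) : C.binomial 𝕜 j ∈ idealOf (C.variety 𝕜) := by
  rw [C.mem_idealOf_iff]
  intro t
  rw [binomial]
  simp only [map_sub, map_mul, map_pow, MvPolynomial.eval_X]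
  rw [C.eval_signedMonomial_eq t (C.w j), C.conePoint_inr t j]
  ring

theorem pderiv_binomial [CharP 𝕜 p] (i : ι) (j : κ) :
    MvPolynomial.pderiv i (C.binomial 𝕜 j) =
      MvPolynomial.pderiv i (MvPolynomial.X (C.σ (Sum.inr j))) *
        MvPolynomial.rename C.basicIndex (signedMonomial 𝕜 (-C.w j)) ^ p -
      MvPolynomial.pderiv i (MvPolynomial.X (C.σ (Sum.inr C.o))) *
        MvPolynomial.rename C.basicIndex (signedMonomial 𝕜 (C.w j)) ^ p := by
  -- In characteristic p, derivations kill p-th powers.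
  have hp : ∀ G : MvPolynomial ι 𝕜, MvPolynomial.pderiv i (G ^ p) = 0 := fun G => by
    rw [Derivation.leibniz_pow, ← Nat.cast_smul_eq_nsmul 𝕜, CharP.cast_eq_zero, zero_smul]
  rw [binomial, map_sub, MvPolynomial.pderiv_mul, MvPolynomial.pderiv_mul, hp, hp]
  ring

/-- A linear relation of the partial derivatives of all elements of the ideal along the
coordinates `y_j` at a torus point is a multiple of the Euler relation. -/
theorem eq_smul_of_forall_sum_pderiv [Infinite 𝕜] [CharP 𝕜 p] [Fintype κ]
    (t : Torus 𝕜 ((Fin n → ℤ) × ℤ)) (z : κ → 𝕜)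
    (hz : ∀ F ∈ idealOf (C.variety 𝕜), ∑ j, MvPolynomial.eval (C.conePoint t)
      (MvPolynomial.pderiv (C.σ (Sum.inr j)) F) * z j = 0) :
    z = (z C.o * (C.conePoint t (C.σ (Sum.inr C.o)))⁻¹) •
      fun j => C.conePoint t (C.σ (Sum.inr j)) := by
  classical
  funext j
  -- The binomial for j gives z_j G^p = z_o H^p at the torus point, and H = z^{w_j} G there.
  have h := hz _ (C.binomial_mem_idealOf j)
  simp only [C.pderiv_binomial, MvPolynomial.pderiv_X, Pi.single_apply, map_sub, map_mul, map_pow,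
    sub_mul, Finset.sum_sub_distrib] at h
  have hinj : ∀ a b : κ, (C.σ (Sum.inr a) = C.σ (Sum.inr b)) ↔ a = b := fun a b => by simp
  simp only [hinj, apply_ite (MvPolynomial.eval (C.conePoint t)), map_one, map_zero, ite_mul,
    one_mul, zero_mul, Finset.sum_ite_eq, Finset.mem_univ, if_true] at h
  have hg := C.eval_signedMonomial_ne_zero t (-C.w j)
  have ho := C.conePoint_ne_zero t (C.σ (Sum.inr C.o))
  rw [C.eval_signedMonomial_eq t (C.w j)] at h
  rw [Pi.smul_apply, smul_eq_mul, C.conePoint_inr t j]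
  generalize MvPolynomial.eval (C.conePoint t)
    (MvPolynomial.rename C.basicIndex (signedMonomial 𝕜 (-C.w j))) = g at h hg
  generalize C.conePoint t (C.σ (Sum.inr C.o)) = y at ho ⊢
  have h1 : g ^ p * (z j - monomialValue t (C.w j, 0) ^ p * z C.o) = 0 := by
    rw [← h]; ring
  have h2 := sub_eq_zero.mp ((mul_eq_zero.mp h1).resolve_left (pow_ne_zero _ hg))
  rw [h2]
  field_simp

end GaussConfig

/-! ### The dimension of the variety, which is n. -/

theorem isAlgebraic_of_mul_eq {S R : Type*} [CommRing S] [CommRing R] [Algebra S R] {a b : S}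
    (ha : a ≠ 0) {x : R} (h : algebraMap S R a * x = algebraMap S R b) : IsAlgebraic S x := by
  refine ⟨Polynomial.C a * Polynomial.X - Polynomial.C b, fun h0 => ha ?_, ?_⟩
  · have h1 := congrArg (fun q => Polynomial.coeff q 1) h0
    simpa [Polynomial.coeff_C] using h1
  · simp [h]

namespace GaussConfig

variable {p n : ℕ} {ι κ : Type*} (C : GaussConfig p n ι κ) {𝕜 : Type*} [Field 𝕜]

theorem exists_smul_torusPoint_eq_conePoint (s : 𝕜ˣ) (t : Torus 𝕜 (Fin n → ℤ)) :
    ∃ t' : Torus 𝕜 ((Fin n → ℤ) × ℤ), (∀ v, monomialValue t' (v, 0) = monomialValue t v) ∧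
      C.conePoint t' = (s : 𝕜) • torusPoint C.u t := by
  let t' : Torus 𝕜 ((Fin n → ℤ) × ℤ) := t.comap (AddMonoidHom.fst _ _) *
    Torus.comap (AddMonoidHom.snd (Fin n → ℤ) ℤ) (zpowersHom 𝕜ˣ s)
  have ht' : ∀ v k, monomialValue t' (v, k) = monomialValue t v * (s : 𝕜) ^ k := fun v k => by
    simp [t', monomialValue, Torus.comap]
  refine ⟨t', fun v => by simp [ht'], ?_⟩
  funext i
  change monomialValue t' (C.u i, 1) = s * monomialValue t (C.u i)
  rw [ht', zpow_one, mul_comm]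

theorem algebraicIndependent_basic [Infinite 𝕜] :
    AlgebraicIndependent 𝕜 fun a =>
      (Ideal.Quotient.mk (idealOf (C.variety 𝕜)) (MvPolynomial.X (C.basicIndex a))) := by
  rw [algebraicIndependent_iff]
  intro F hF
  have hrename : Ideal.Quotient.mk (idealOf (C.variety 𝕜)) (MvPolynomial.rename C.basicIndex F) = 0 := by
    rw [← hF]
    have : (Ideal.Quotient.mkₐ 𝕜 (idealOf (C.variety 𝕜))).comp (MvPolynomial.rename C.basicIndex) =
        MvPolynomial.aeval fun a =>
          (Ideal.Quotient.mk (idealOf (C.variety 𝕜)) (MvPolynomial.X (C.basicIndex a))) := by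
      ext a; simp
    exact DFunLike.congr_fun this F
  rw [Ideal.Quotient.eq_zero_iff_mem, C.mem_idealOf_iff] at hrename
  -- The coordinates x_i and y_o take arbitrary nonzero values on the cone over the torus: scale by
  -- the value wanted for y_o, and take a torus point with coordinates the remaining quotients.
  refine MvPolynomial.funext_set (fun _ => {0}ᶜ)
    (fun _ => (Set.finite_singleton 0).infinite_compl) fun z hz => ?_
  have hz' : ∀ a, z a ≠ 0 := fun a => hz a (Set.mem_univ a)
  obtain ⟨t, ht⟩ := exists_torus_basis (𝕜 := 𝕜) (Pi.basisFun ℤ (Fin n))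
    fun i => Units.mk0 (z (some i)) (hz' _) * (Units.mk0 (z none) (hz' _))⁻¹
  obtain ⟨t', -, ht'⟩ := C.exists_smul_torusPoint_eq_conePoint (Units.mk0 (z none) (hz' _)) t
  have h := hrename t'
  rw [MvPolynomial.eval_rename, ht'] at h
  rw [map_zero, ← h]
  congr 2
  funext a
  have hn := hz' none
  cases a with
  | none => simp [basicIndex, C.u_inr, C.w_o]
  | some i =>
    have := ht i
    simp only [Pi.basisFun_apply] at this
    simp [basicIndex, C.u_inl, this]
    field_simp

/-- The binomial y_j G^p = y_o H^p makes each y_j algebraic over the x_i and y_o, since G is not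
zero on the variety. -/
theorem isTranscendenceBasis_basic [Infinite 𝕜] :
    IsTranscendenceBasis 𝕜 fun a =>
      (Ideal.Quotient.mk (idealOf (C.variety 𝕜)) (MvPolynomial.X (C.basicIndex a))) := by
  have := C.isPrime_idealOf (𝕜 := 𝕜)
  rw [C.algebraicIndependent_basic.isTranscendenceBasis_iff_isAlgebraic]
  set I := idealOf (C.variety 𝕜)
  set S := Algebra.adjoin 𝕜 (Set.range fun a => Ideal.Quotient.mk I (MvPolynomial.X (C.basicIndex a)))
  have hS : ∀ F : MvPolynomial (Option (Fin n)) 𝕜,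
      Ideal.Quotient.mk I (MvPolynomial.rename C.basicIndex F) ∈ S := by
    intro F
    induction F using MvPolynomial.induction_on with
    | C a =>
      rw [MvPolynomial.rename_C]
      exact S.algebraMap_mem a
    | add F G hF hG => rw [map_add, map_add]; exact S.add_mem hF hG
    | mul_X F a hF =>
      rw [map_mul, map_mul, MvPolynomial.rename_X]
      exact S.mul_mem hF (Algebra.subset_adjoin ⟨a, rfl⟩)
  have halg : ∀ s ∈ S, IsAlgebraic S s := fun s hs => isAlgebraic_algebraMap (⟨s, hs⟩ : S)
  refine ⟨fun r => ?_⟩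
  obtain ⟨F, rfl⟩ := Ideal.Quotient.mk_surjective r
  induction F using MvPolynomial.induction_on with
  | C a => exact halg _ (S.algebraMap_mem a)
  | add F G hF hG => rw [map_add]; exact hF.add hG
  | mul_X F i hF =>
    rw [map_mul]
    refine hF.mul ?_
    obtain ⟨i | j, rfl⟩ := C.σ.surjective i
    · exact halg _ (Algebra.subset_adjoin ⟨some i, rfl⟩)
    · have hb := C.binomial_mem_idealOf (𝕜 := 𝕜) j
      rw [← Ideal.Quotient.eq_zero_iff_mem, binomial, map_sub, map_mul, map_pow, map_mul,
        map_pow] at hb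
      let a : S := ⟨_, hS (signedMonomial 𝕜 (-C.w j))⟩
      let b : S := ⟨_, hS (signedMonomial 𝕜 (C.w j))⟩
      let y : S := ⟨Ideal.Quotient.mk I (MvPolynomial.X (C.σ (Sum.inr C.o))),
        Algebra.subset_adjoin ⟨none, rfl⟩⟩
      have ha : a ≠ 0 := by
        intro h0
        have h1 := Ideal.Quotient.eq_zero_iff_mem.mp (congrArg Subtype.val h0)
        rw [C.mem_idealOf_iff] at h1
        exact C.eval_signedMonomial_ne_zero 1 _ (h1 1)
      refine isAlgebraic_of_mul_eq (pow_ne_zero p ha) (b := y * b ^ p) ?_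
      rw [mul_comm]
      exact sub_eq_zero.mp hb

theorem coneDim_variety [Infinite 𝕜] : coneDim (C.variety 𝕜) = n + 1 := by
  have := C.isPrime_idealOf (𝕜 := 𝕜)
  have h := C.isTranscendenceBasis_basic (𝕜 := 𝕜).lift_cardinalMk_eq_trdeg
  have h' := congrArg Cardinal.toNat h
  rw [Cardinal.toNat_lift, Cardinal.toNat_lift] at h'
  rw [coneDim, ← h']
  simp

/-- The decomposition of the ambient vector space into the coordinates of the basis vectors and
the remaining ones. -/
noncomputable def split (𝕜 : Type*) [Field 𝕜] : ((Fin n → 𝕜) × (κ → 𝕜)) ≃ₗ[𝕜] (ι → 𝕜) :=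
  (LinearEquiv.sumArrowLequivProdArrow (Fin n) κ 𝕜 𝕜).symm ≪≫ₗ
    LinearEquiv.funCongrLeft 𝕜 𝕜 C.σ.symm

@[simp] theorem split_inl (a : Fin n → 𝕜) (b : κ → 𝕜) (i : Fin n) :
    C.split 𝕜 (a, b) (C.σ (Sum.inl i)) = a i := by
  simp [split]

@[simp] theorem split_inr (a : Fin n → 𝕜) (b : κ → 𝕜) (j : κ) :
    C.split 𝕜 (a, b) (C.σ (Sum.inr j)) = b j := by
  simp [split]

/-- The intersection of the tangent space with the coordinate subspace of the `y_j`. -/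
noncomputable def yTangent [Fintype ι] (x : ι → 𝕜) : Submodule 𝕜 (κ → 𝕜) :=
  (coneTangentSpace (C.variety 𝕜) x).comap
    ((C.split 𝕜).toLinearMap ∘ₗ LinearMap.inr 𝕜 (Fin n → 𝕜) (κ → 𝕜))

theorem eval_eq_zero {x : ι → 𝕜} (hx : x ∈ affineCone (C.variety 𝕜)) {F : MvPolynomial ι 𝕜}
    (hF : F ∈ idealOf (C.variety 𝕜)) : MvPolynomial.eval x F = 0 :=
  GaussToric.mem_idealOf_iff.mp hF x hx

theorem conePoint_mem_affineCone [Infinite 𝕜] (t : Torus 𝕜 ((Fin n → ℤ) × ℤ)) :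
    C.conePoint t ∈ affineCone (C.variety 𝕜) := by
  intro hx
  have := C.nonempty
  refine subset_closure ⟨t.comap (AddMonoidHom.inl _ ℤ), torusPoint_ne_zero _ _, ?_⟩
  rw [Projectivization.mk_eq_mk_iff']
  exact ⟨monomialValue t (0, 1), (torusPoint_coneExponent C.u t).symm⟩

/-- The scalar in the chosen representative of a projective point is absorbed by the ℤ-factor of the
torus of the cone. -/
theorem exists_rep_eq_conePoint (t : Torus 𝕜 (Fin n → ℤ)) (h : torusPoint C.u t ≠ 0) :
    ∃ t' : Torus 𝕜 ((Fin n → ℤ) × ℤ), (∀ v, monomialValue t' (v, 0) = monomialValue t v) ∧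
      (Projectivization.mk 𝕜 (torusPoint C.u t) h).rep = C.conePoint t' := by
  obtain ⟨a, ha⟩ := Projectivization.exists_smul_eq_mk_rep 𝕜 _ h
  obtain ⟨t', h', ht'⟩ := C.exists_smul_torusPoint_eq_conePoint a t
  exact ⟨t', h', by rw [ht', ← ha]; rfl⟩

/-! ### Tangent spaces and the smooth locus. -/

section Tangent

variable [Fintype ι] [Fintype κ]

theorem mem_yTangent {x : ι → 𝕜} {z : κ → 𝕜} :
    z ∈ C.yTangent x ↔ ∀ F ∈ idealOf (C.variety 𝕜), ∑ j, MvPolynomial.eval x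
      (MvPolynomial.pderiv (C.σ (Sum.inr j)) F) * z j = 0 := by
  refine forall₂_congr fun F _ => ?_
  rw [C.sum_eq]
  simp

/-- The derivatives of ideal elements along the x_i vanish on the whole cone, so the tangent
conditions concern the y-part only. This holds at all points of the variety, not only on the torus.
-/
theorem split_mem_coneTangentSpace [Infinite 𝕜] [CharP 𝕜 p] {x : ι → 𝕜}
    (hx : x ∈ affineCone (C.variety 𝕜)) (a : Fin n → 𝕜) (b : κ → 𝕜) :
    C.split 𝕜 (a, b) ∈ coneTangentSpace (C.variety 𝕜) x ↔ b ∈ C.yTangent x := by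
  rw [mem_yTangent]
  refine forall₂_congr fun F hF => ?_
  rw [C.sum_eq]
  simp [C.eval_eq_zero hx (C.pderiv_inl_mem_idealOf hF _)]

theorem map_split_prod [Infinite 𝕜] [CharP 𝕜 p] {x : ι → 𝕜}
    (hx : x ∈ affineCone (C.variety 𝕜)) :
    coneTangentSpace (C.variety 𝕜) x =
      ((⊤ : Submodule 𝕜 (Fin n → 𝕜)).prod (C.yTangent x)).map (C.split 𝕜).toLinearMap := by
  ext v
  obtain ⟨⟨a, b⟩, rfl⟩ := (C.split 𝕜).surjective v
  rw [C.split_mem_coneTangentSpace hx]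
  constructor
  · intro h
    exact ⟨(a, b), ⟨trivial, h⟩, rfl⟩
  · rintro ⟨⟨a', b'⟩, h, h'⟩
    have := (C.split 𝕜).injective h'
    rw [Prod.mk.injEq] at this
    rw [← this.2]
    exact h.2

theorem finrank_coneTangentSpace [Infinite 𝕜] [CharP 𝕜 p] {x : ι → 𝕜}
    (hx : x ∈ affineCone (C.variety 𝕜)) :
    Module.finrank 𝕜 (coneTangentSpace (C.variety 𝕜) x) =
      n + Module.finrank 𝕜 (C.yTangent x) := by
  let e : ((⊤ : Submodule 𝕜 (Fin n → 𝕜)).prod (C.yTangent x)) ≃ₗ[𝕜]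
      (Fin n → 𝕜) × C.yTangent x :=
    { toFun := fun z => (z.1.1, ⟨z.1.2, z.2.2⟩)
      invFun := fun z => ⟨(z.1, z.2), trivial, z.2.2⟩
      map_add' := fun _ _ => rfl
      map_smul' := fun _ _ => rfl
      left_inv := fun _ => rfl
      right_inv := fun _ => rfl }
  rw [C.map_split_prod hx, LinearEquiv.finrank_map_eq, e.finrank_eq, Module.finrank_prod,
    Module.finrank_fin_fun]

theorem mem_yTangent_self [Infinite 𝕜] [CharP 𝕜 p] {x : ι → 𝕜}
    (hx : x ∈ affineCone (C.variety 𝕜)) : (fun j => x (C.σ (Sum.inr j))) ∈ C.yTangent x := by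
  rw [mem_yTangent]
  intro F hF
  simpa [mul_comm] using C.eval_eq_zero hx (C.euler_mem_idealOf hF)

/-- The binomials bound the space from above, the Euler relation from below. -/
theorem yTangent_conePoint [Infinite 𝕜] [CharP 𝕜 p] (t : Torus 𝕜 ((Fin n → ℤ) × ℤ)) :
    C.yTangent (C.conePoint t) = Submodule.span 𝕜 {fun j => C.conePoint t (C.σ (Sum.inr j))} := by
  apply le_antisymm
  · intro z hz
    rw [mem_yTangent] at hz
    rw [C.eq_smul_of_forall_sum_pderiv t z hz]
    exact Submodule.smul_mem _ _ (Submodule.mem_span_singleton_self _)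
  · rw [Submodule.span_singleton_le_iff_mem]
    exact C.mem_yTangent_self (C.conePoint_mem_affineCone t)

theorem mem_smoothLocus_iff [Infinite 𝕜] [CharP 𝕜 p] {P : ℙ 𝕜 (ι → 𝕜)} :
    P ∈ smoothLocus (C.variety 𝕜) ↔
      P ∈ C.variety 𝕜 ∧ Module.finrank 𝕜 (C.yTangent P.rep) = 1 := by
  change _ ∧ _ ↔ _
  refine and_congr_right fun hP => ?_
  rw [embeddedTangentSpace, C.finrank_coneTangentSpace (rep_mem_affineCone hP), C.coneDim_variety]
  omega

theorem monomialImage_subset_smoothLocus [Infinite 𝕜] [CharP 𝕜 p] :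
    monomialImage 𝕜 C.u ⊆ smoothLocus (C.variety 𝕜) := by
  rintro _ ⟨t, h, rfl⟩
  rw [C.mem_smoothLocus_iff]
  refine ⟨subset_closure ⟨t, h, rfl⟩, ?_⟩
  obtain ⟨t', -, ht'⟩ := C.exists_rep_eq_conePoint t h
  rw [ht', C.yTangent_conePoint]
  exact finrank_span_singleton fun h0 => C.conePoint_ne_zero t' _ (congrFun h0 C.o)

end Tangent

end GaussConfig

/-! ### Plücker coordinates of the tangent spaces. -/

/-- The factor is the determinant of the matrix that expresses b' through b. -/
theorem pluckerCoords_eq_smul {𝕜 ι : Type*} [Field 𝕜] [Fintype ι] [LinearOrder ι] {m : ℕ}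
    {b b' : Fin m → ι → 𝕜} (h : ∀ r, b' r ∈ Submodule.span 𝕜 (Set.range b)) :
    ∃ a : 𝕜, a • pluckerCoords b = pluckerCoords b' := by
  choose A hA using fun r => (Submodule.mem_span_range_iff_exists_fun 𝕜).mp (h r)
  refine ⟨(Matrix.of A).det, ?_⟩
  funext s
  rw [Pi.smul_apply, pluckerCoords, pluckerCoords, smul_eq_mul, ← Matrix.det_mul]
  congr 1
  ext r c
  rw [Matrix.mul_apply]
  simp [← hA, Finset.sum_apply]

namespace GaussConfig

variable {p n : ℕ} {ι κ : Type*} (C : GaussConfig p n ι κ) {𝕜 : Type*} [Field 𝕜]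

/-- The family consisting of the basis vectors of the coordinate subspace of the `x_i` and of a
vector of the coordinate subspace of the `y_j`. -/
noncomputable def frame {m : ℕ} (hm : m = n + 1) (v : κ → 𝕜) : Fin m → ι → 𝕜 :=
  fun r => Fin.snoc (α := fun _ => ι → 𝕜) (fun i => C.split 𝕜 (Pi.single i 1, 0))
    (C.split 𝕜 (0, v)) (Fin.cast hm r)

theorem linearIndependent_frame {m : ℕ} (hm : m = n + 1) {v : κ → 𝕜} (hv : v ≠ 0) :
    LinearIndependent 𝕜 (C.frame hm v) := by
  subst hm
  refine linearIndependent_finSnoc.mpr ⟨?_, fun h => hv ?_⟩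
  · have h1 := (Pi.basisFun 𝕜 (Fin n)).linearIndependent.map'
      ((C.split 𝕜).toLinearMap ∘ₗ LinearMap.inl 𝕜 (Fin n → 𝕜) (κ → 𝕜))
      (LinearMap.ker_eq_bot.mpr ((C.split 𝕜).injective.comp LinearMap.inl_injective))
    have h2 : (((C.split 𝕜).toLinearMap ∘ₗ LinearMap.inl 𝕜 (Fin n → 𝕜) (κ → 𝕜)) ∘
        (Pi.basisFun 𝕜 (Fin n))) = fun i => C.split 𝕜 (Pi.single i 1, 0) := by
      funext i
      simp
    rwa [h2] at h1
  · have hle : Submodule.span 𝕜 (Set.range fun i : Fin n => C.split 𝕜 (Pi.single i 1, 0)) ≤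
        LinearMap.ker (LinearMap.snd 𝕜 (Fin n → 𝕜) (κ → 𝕜) ∘ₗ (C.split 𝕜).symm.toLinearMap) := by
      rw [Submodule.span_le]
      rintro _ ⟨i, rfl⟩
      simp
    simpa using hle h

theorem exists_yTangent_eq [Fintype ι] [Fintype κ] [Infinite 𝕜] [CharP 𝕜 p]
    (P : smoothLocus (C.variety 𝕜)) :
    ∃ v : κ → 𝕜, v ≠ 0 ∧ C.yTangent P.1.rep = Submodule.span 𝕜 {v} := by
  obtain ⟨v, hv, h⟩ := finrank_eq_one_iff'.mp (C.mem_smoothLocus_iff.mp P.2).2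
  refine ⟨v, fun h0 => hv (Subtype.ext h0), le_antisymm (fun z hz => ?_) ?_⟩
  · obtain ⟨a, ha⟩ := h ⟨z, hz⟩
    exact Submodule.mem_span_singleton.mpr ⟨a, congrArg Subtype.val ha⟩
  · rw [Submodule.span_singleton_le_iff_mem]
    exact v.2

variable [LinearOrder ι]

/-- The Plücker coordinates of the span of the coordinate subspace of the `x_i` and of a vector of
the coordinate subspace of the `y_j`, as a linear map of this vector. -/
noncomputable def pluckerMap (𝕜 : Type*) [Field 𝕜] {m : ℕ} (hm : m = n + 1) :
    (κ → 𝕜) →ₗ[𝕜] ((Fin m ↪o ι) → 𝕜) :=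
  LinearMap.pi fun s =>
    Matrix.detRowAlternating.toMultilinearMap.toLinearMap
      (fun r c => C.frame hm (0 : κ → 𝕜) r (s c)) (Fin.cast hm.symm (Fin.last n)) ∘ₗ
    LinearMap.funLeft 𝕜 𝕜 s ∘ₗ (C.split 𝕜).toLinearMap ∘ₗ
    LinearMap.inr 𝕜 (Fin n → 𝕜) (κ → 𝕜)

theorem pluckerMap_apply {m : ℕ} (hm : m = n + 1) (v : κ → 𝕜) :
    C.pluckerMap 𝕜 hm v = pluckerCoords (C.frame hm v) := by
  subst hm
  funext s
  change Matrix.det _ = Matrix.det _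
  congr 1
  ext r c
  refine Fin.lastCases ?_ (fun i => ?_) r
  · simp [frame, LinearMap.funLeft]
  · simp [frame, Fin.castSucc_ne_last]

variable [Fintype ι]

theorem pluckerMap_injective {m : ℕ} (hm : m = n + 1) :
    Function.Injective (C.pluckerMap 𝕜 hm) := by
  rw [injective_iff_map_eq_zero]
  intro v h
  by_contra hv
  exact pluckerCoords_ne_zero _ (C.linearIndependent_frame hm hv) (by rw [← pluckerMap_apply, h])

theorem plucker_eq {m : ℕ} (hm : m = n + 1) {v : κ → 𝕜} (hv : v ≠ 0)
    (W : Submodule 𝕜 (ι → 𝕜)) (hW : Module.finrank 𝕜 W = m)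
    (h : W = ((⊤ : Submodule 𝕜 (Fin n → 𝕜)).prod (Submodule.span 𝕜 {v})).map
      (C.split 𝕜).toLinearMap) :
    plucker W hW = Projectivization.map (C.pluckerMap 𝕜 hm) (C.pluckerMap_injective hm)
      (Projectivization.mk 𝕜 v hv) := by
  rw [Projectivization.map_mk, plucker]
  have hspan : Submodule.span 𝕜 (Set.range fun r =>
      (Module.finBasisOfFinrankEq 𝕜 W hW r : ι → 𝕜)) = W := by
    have h1 := (Module.finBasisOfFinrankEq 𝕜 W hW).span_eq
    have h2 := congrArg (Submodule.map W.subtype) h1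
    rw [Submodule.map_span, ← Set.range_comp, Submodule.map_top, Submodule.range_subtype] at h2
    exact h2
  refine ((Projectivization.mk_eq_mk_iff' 𝕜 _ _ _ _).mpr ?_).symm
  rw [pluckerMap_apply]
  refine pluckerCoords_eq_smul fun r => ?_
  rw [hspan, h]
  subst hm
  refine Fin.lastCases ?_ (fun i => ?_) r
  · exact ⟨(0, v), ⟨trivial, Submodule.mem_span_singleton_self v⟩, by simp [frame]⟩
  · exact ⟨(Pi.single i 1, 0), ⟨trivial, Submodule.zero_mem _⟩, by simp [frame]⟩

variable [Fintype κ] [Infinite 𝕜] [CharP 𝕜 p]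

/-- The linear embedding of the projective space of the `y_j` in the Plücker space. -/
noncomputable def pluckerEmbedding : ℙ 𝕜 (κ → 𝕜) → ℙ 𝕜 ((Fin (coneDim (C.variety 𝕜)) ↪o ι) → 𝕜) :=
  Projectivization.map (C.pluckerMap 𝕜 C.coneDim_variety)
    (C.pluckerMap_injective C.coneDim_variety)

theorem gaussMap_eq (P : smoothLocus (C.variety 𝕜)) {v : κ → 𝕜} (hv : v ≠ 0)
    (h : C.yTangent P.1.rep = Submodule.span 𝕜 {v}) :
    gaussMap (C.variety 𝕜) P = C.pluckerEmbedding (Projectivization.mk 𝕜 v hv) :=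
  C.plucker_eq _ hv _ _ (by
    rw [embeddedTangentSpace, C.map_split_prod (rep_mem_affineCone P.2.1), h])

theorem gaussMap_eq_iff (P : smoothLocus (C.variety 𝕜)) {v : κ → 𝕜} (hv : v ≠ 0) :
    gaussMap (C.variety 𝕜) P = C.pluckerEmbedding (Projectivization.mk 𝕜 v hv) ↔
      C.yTangent P.1.rep = Submodule.span 𝕜 {v} := by
  refine ⟨fun h => ?_, C.gaussMap_eq P hv⟩
  obtain ⟨v', hv', h'⟩ := C.exists_yTangent_eq P
  rw [C.gaussMap_eq P hv' h'] at h
  have h1 := Projectivization.map_injective _ (C.pluckerMap_injective C.coneDim_variety) h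
  rw [← Projectivization.submodule_mk v hv, ← h1, Projectivization.submodule_mk, h']

end GaussConfig

/-! ### The Gauss map at arbitrary smooth points, and its image. -/

/-- Cramer's rule: multiply N y = y_o e_o by the adjugate. It recovers y up to a scalar as a column
of polynomial expressions in the entries of N. -/
theorem adjugate_mul_eq {κ R : Type*} [Fintype κ] [DecidableEq κ] [CommRing R] (N : Matrix κ κ R)
    (y : κ → R) (o i : κ) (h : N.mulVec y = Pi.single o (y o)) :
    N.adjugate i o * y o = N.det * y i := by
  have h1 := congrArg (fun z => N.adjugate.mulVec z i) h
  simp only [Matrix.mulVec_mulVec, Matrix.adjugate_mul, Matrix.smul_mulVec, Matrix.one_mulVec,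
    Pi.smul_apply, smul_eq_mul, Matrix.mulVec_single] at h1
  rw [h1]
  simp

namespace GaussConfig

variable {p n : ℕ} {ι κ : Type*} (C : GaussConfig p n ι κ) {𝕜 : Type*} [Field 𝕜]

theorem conePoint_inr_eq (t : Torus 𝕜 ((Fin n → ℤ) × ℤ)) (j : κ) :
    C.conePoint t (C.σ (Sum.inr j)) =
      monomialValue t (0, 1) * monomialValue t (p • C.w j, 0) := by
  rw [← monomialValue_add]
  simp [coneExponent, C.u_inr]

variable [Fintype ι] [Fintype κ]

/-- By duality: the y-gradients at x of ideal elements form a subspace with annihilator `yTangent`,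
which lies in the line of v; hence every form that kills v is such a gradient. -/
theorem exists_mem_idealOf_pderiv_eq {x : ι → 𝕜} {v : κ → 𝕜}
    (h : C.yTangent x ≤ Submodule.span 𝕜 {v}) (ℓ : κ → 𝕜) (hℓ : ∑ j, ℓ j * v j = 0) :
    ∃ F ∈ idealOf (C.variety 𝕜), ∀ j,
      MvPolynomial.eval x (MvPolynomial.pderiv (C.σ (Sum.inr j)) F) = ℓ j := by
  classical
  let D : MvPolynomial ι 𝕜 →ₗ[𝕜] (κ → 𝕜) := LinearMap.pi fun j =>
    (MvPolynomial.aeval x).toLinearMap ∘ₗ (MvPolynomial.pderiv (C.σ (Sum.inr j))).toLinearMap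
  let G : Submodule 𝕜 (κ → 𝕜) := ((idealOf (C.variety 𝕜)).restrictScalars 𝕜).map D
  suffices hG : ℓ ∈ G by
    obtain ⟨F, hF, hFℓ⟩ := hG
    exact ⟨F, hF, fun j => congrFun hFℓ j⟩
  by_contra hℓG
  obtain ⟨f, hfℓ, hf⟩ := Submodule.exists_le_ker_of_notMem hℓG
  have hfsum : ∀ z, f z = ∑ j, z j * f (Pi.single j 1) := fun z => by
    conv_lhs => rw [pi_eq_sum_univ' z]
    simp [map_sum]
  have hmem : (fun j => f (Pi.single j 1)) ∈ C.yTangent x := by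
    rw [mem_yTangent]
    intro F hF
    have h1 : f (D F) = 0 := hf ⟨F, hF, rfl⟩
    rw [hfsum] at h1
    exact h1
  obtain ⟨a, ha⟩ := Submodule.mem_span_singleton.mp (h hmem)
  apply hfℓ
  rw [hfsum]
  have ha' : ∀ j, f (Pi.single j 1) = a * v j := fun j => (congrFun ha j).symm
  simp only [ha']
  rw [← mul_zero a, ← hℓ, Finset.mul_sum]
  exact Finset.sum_congr rfl fun j _ => by ring

/-- Near a smooth point, the Gauss map is given by polynomials. -/
theorem exists_polynomials_yTangent [Infinite 𝕜] [CharP 𝕜 p] {x : ι → 𝕜} {v : κ → 𝕜} (hv : v ≠ 0)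
    (h : C.yTangent x = Submodule.span 𝕜 {v}) :
    ∃ (Q : κ → MvPolynomial ι 𝕜) (a : 𝕜), a ≠ 0 ∧
      (∀ j, MvPolynomial.eval x (Q j) = a * v j) ∧
      ∀ t : Torus 𝕜 ((Fin n → ℤ) × ℤ), ∃ b : 𝕜, ∀ j,
        MvPolynomial.eval (C.conePoint t) (Q j) = b * C.conePoint t (C.σ (Sum.inr j)) := by
  classical
  obtain ⟨o, ho⟩ := Function.ne_iff.mp hv
  rw [Pi.zero_apply] at ho
  -- F_j has the y-gradient v_o e_j - v_j e_o at x; for j ≠ o these span all forms that kill v.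
  choose F hF hFx using fun j => C.exists_mem_idealOf_pderiv_eq h.le
    (fun i => v o * (Pi.single j 1 : κ → 𝕜) i - v j * (Pi.single o 1 : κ → 𝕜) i) (by
      simp [sub_mul, Finset.sum_sub_distrib, Pi.single_apply]
      ring)
  -- The rows j ≠ o are the y-gradients of the F_j and row o is e_o. The Euler relation gives N y =
  -- y_o e_o at torus points, and N v = v_o e_o holds at x, so column o of the adjugate is
  -- proportional to y and to v respectively.
  let N : Matrix κ κ (MvPolynomial ι 𝕜) := Matrix.of fun j i =>
    if j = o then (if i = o then 1 else 0) else MvPolynomial.pderiv (C.σ (Sum.inr i)) (F j)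
  let Nq (q : ι → 𝕜) : Matrix κ κ 𝕜 := (MvPolynomial.eval q).mapMatrix N
  have hNq : ∀ q j i, Nq q j i = if j = o then (if i = o then 1 else 0) else
      MvPolynomial.eval q (MvPolynomial.pderiv (C.σ (Sum.inr i)) (F j)) := fun q j i => by
    change MvPolynomial.eval q (if j = o then (if i = o then 1 else 0) else _) = _
    split_ifs <;> simp
  have hadj : ∀ q i, MvPolynomial.eval q (N.adjugate i o) = (Nq q).adjugate i o := fun q i => by
    have := congrFun (congrFun (RingHom.map_adjugate (MvPolynomial.eval q) N) i) o
    exact this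
  have hmulVec : ∀ (q : ι → 𝕜) (y : κ → 𝕜), (∀ j, ∑ i, MvPolynomial.eval q
      (MvPolynomial.pderiv (C.σ (Sum.inr i)) (F j)) * y i = 0) →
      (Nq q).mulVec y = Pi.single o (y o) := by
    intro q y hy
    funext j
    rw [Matrix.mulVec, dotProduct]
    by_cases hj : j = o
    · subst hj
      simp [hNq]
    · simp [hNq, hj, hy]
  refine ⟨fun i => N.adjugate i o, (Nq x).det / v o, ?_, fun j => ?_, fun t => ?_⟩
  -- A kernel vector z of the matrix at x has z_o = 0 by row o, and then v_o z_j = 0 by row j.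
  · refine div_ne_zero (fun hdet => ?_) ho
    obtain ⟨z, hz, hNz⟩ := Matrix.exists_mulVec_eq_zero_iff.mpr hdet
    apply hz
    have hzo : z o = 0 := by
      have := congrFun hNz o
      simpa [Matrix.mulVec, dotProduct, hNq] using this
    funext j
    by_cases hj : j = o
    · rw [hj, hzo]; rfl
    · have := congrFun hNz j
      simp [Matrix.mulVec, dotProduct, hNq, hj, hFx, sub_mul, Finset.sum_sub_distrib,
        Pi.single_apply, hzo, ho] at this
      exact this
  · have h1 := adjugate_mul_eq (Nq x) v o j (hmulVec x v fun k => by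
      have hvmem : v ∈ C.yTangent x := by rw [h]; exact Submodule.mem_span_singleton_self v
      exact C.mem_yTangent.mp hvmem _ (hF k))
    rw [hadj]
    field_simp
    exact h1
  · have hy := C.conePoint_ne_zero t (C.σ (Sum.inr o))
    refine ⟨(Nq (C.conePoint t)).det / C.conePoint t (C.σ (Sum.inr o)), fun j => ?_⟩
    have h1 := adjugate_mul_eq (Nq (C.conePoint t)) (fun i => C.conePoint t (C.σ (Sum.inr i))) o j
      (hmulVec _ _ fun k => C.mem_yTangent.mp
        (C.mem_yTangent_self (C.conePoint_mem_affineCone t)) _ (hF k))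
    rw [hadj]
    field_simp
    exact h1

/-- A form G vanishing on the image of the y-monomials gives G ∘ Q in the ideal of the variety; its
value at x is a power of a ≠ 0 times G(v). -/
theorem mk_mem_closure_of_yTangent_eq [Infinite 𝕜] [CharP 𝕜 p] {x : ι → 𝕜}
    (hx : x ∈ affineCone (C.variety 𝕜)) {v : κ → 𝕜} (hv : v ≠ 0)
    (h : C.yTangent x = Submodule.span 𝕜 {v}) :
    Projectivization.mk 𝕜 v hv ∈ closure (monomialImage 𝕜 fun j => p • C.w j) := by
  obtain ⟨Q, a, ha, hQx, hQ⟩ := C.exists_polynomials_yTangent hv h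
  rw [mem_closure_iff_forall_eval]
  intro G d hG hvan
  have heval : ∀ q, MvPolynomial.eval q (MvPolynomial.bind₁ Q G) =
      MvPolynomial.eval (fun j => MvPolynomial.eval q (Q j)) G := fun q => by
    rw [MvPolynomial.eval, MvPolynomial.eval₂Hom_bind₁]
    rfl
  have hmem : MvPolynomial.bind₁ Q G ∈ idealOf (C.variety 𝕜) := by
    rw [C.mem_idealOf_iff]
    intro t
    obtain ⟨b, hb⟩ := hQ t
    have hb' : (fun j => MvPolynomial.eval (C.conePoint t) (Q j)) =
        (b * monomialValue t (0, 1)) • torusPoint (fun j => p • C.w j)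
          (t.comap (AddMonoidHom.inl _ ℤ)) := by
      funext j
      rw [hb, conePoint_inr_eq, ← mul_assoc]
      rfl
    rw [heval, hb', eval_smul_of_isHomogeneous hG]
    have := Nonempty.intro C.o
    have h0 := hvan _ ⟨t.comap (AddMonoidHom.inl _ ℤ), torusPoint_ne_zero _ _, rfl⟩
    rw [eval_rep_mk_eq_zero_iff hG] at h0
    rw [h0, mul_zero]
  have h0 := C.eval_eq_zero hx hmem
  have hav : (fun j => MvPolynomial.eval x (Q j)) = a • v := by
    funext j
    rw [hQx]
    rfl
  rw [heval, hav, eval_smul_of_isHomogeneous hG] at h0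
  rw [eval_rep_mk_eq_zero_iff hG]
  exact (mul_eq_zero.mp h0).resolve_left (pow_ne_zero _ ha)

theorem yTangent_rep_mk [Infinite 𝕜] [CharP 𝕜 p] (t : Torus 𝕜 (Fin n → ℤ))
    (h : torusPoint C.u t ≠ 0) : C.yTangent (Projectivization.mk 𝕜 (torusPoint C.u t) h).rep =
      Submodule.span 𝕜 {torusPoint (fun j => p • C.w j) t} := by
  obtain ⟨t', ht', hrep⟩ := C.exists_rep_eq_conePoint t h
  rw [hrep, C.yTangent_conePoint]
  have : (fun j => C.conePoint t' (C.σ (Sum.inr j))) =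
      monomialValue t' (0, 1) • torusPoint (fun j => p • C.w j) t := by
    funext j
    rw [conePoint_inr_eq, ht']
    rfl
  rw [this]
  exact Submodule.span_singleton_smul_eq (monomialValue_ne_zero _ _).isUnit _

theorem gaussImage_variety [LinearOrder ι] [Infinite 𝕜] [CharP 𝕜 p] :
    gaussImage (C.variety 𝕜) =
      C.pluckerEmbedding '' closure (monomialImage 𝕜 fun j => p • C.w j) := by
  have hcl : C.pluckerEmbedding '' closure (monomialImage 𝕜 fun j => p • C.w j) =
      closure (C.pluckerEmbedding '' monomialImage 𝕜 fun j => p • C.w j) :=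
    (closure_image_map _ _ _).symm
  apply Set.Subset.antisymm
  · refine closure_minimal ?_ (hcl ▸ isClosed_closure)
    rintro _ ⟨P, rfl⟩
    obtain ⟨v, hv, h⟩ := C.exists_yTangent_eq P
    rw [C.gaussMap_eq P hv h]
    exact ⟨_, C.mk_mem_closure_of_yTangent_eq (rep_mem_affineCone P.2.1) hv h, rfl⟩
  · rw [hcl]
    refine closure_mono ?_
    rintro _ ⟨_, ⟨t, ht, rfl⟩, rfl⟩
    have := C.nonempty
    refine ⟨⟨_, C.monomialImage_subset_smoothLocus ⟨t, torusPoint_ne_zero _ _, rfl⟩⟩, ?_⟩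
    rw [C.gaussMap_eq_iff]
    exact C.yTangent_rep_mk t _

end GaussConfig

/-! ### The group acting on the fibers, and smooth points outside the torus. -/

namespace GaussConfig

variable {p n : ℕ} {ι κ : Type*} (C : GaussConfig p n ι κ) (𝕜 : Type*) [Field 𝕜]

/-- The subgroup of the torus that fixes all `y_j`. -/
def fiberGroup : Subgroup (Torus 𝕜 (Fin n → ℤ)) where
  carrier := {h | ∀ j, monomialValue h (p • C.w j) = 1}
  one_mem' := fun j => monomialValue_one _
  mul_mem' := fun {a b} ha hb j => by rw [monomialValue_mul, ha j, hb j, one_mul]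
  inv_mem' := fun {a} ha j => by rw [monomialValue_inv, ha j, inv_one]

/-- The characters of the torus are separated by `C.fiberGroup` up to the lattice generated by
the `w j`. -/
def Separates : Prop :=
  ∀ a b : Fin n → ℤ, (∀ h ∈ C.fiberGroup 𝕜, monomialValue h a = monomialValue h b) →
    ∃ z : κ → ℤ, a - b = ∑ᶠ j, z j • C.w j

variable {𝕜}

variable [Fintype κ]

theorem exists_sum_smul_eq {a b : Fin n → ℤ} (h : ∃ z : κ → ℤ, a - b = ∑ᶠ j, z j • C.w j) :
    ∃ k l : κ → ℕ, ∑ j, k j = ∑ j, l j ∧ a + ∑ j, k j • C.w j = b + ∑ j, l j • C.w j := by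
  classical
  obtain ⟨z, hz⟩ := h
  rw [finsum_eq_sum_of_fintype] at hz
  -- As w_o = 0, the coefficient at o is free; it is adjusted so that the coefficients add up to
  -- zero, and positive and negative parts then have equal sums.
  let z' : κ → ℤ := z - Pi.single C.o (∑ j, z j)
  have hz' : ∑ j, z' j = 0 := by simp [z']
  have hw : ∑ j, z' j • C.w j = a - b := by
    rw [hz]
    refine Finset.sum_congr rfl fun j _ => ?_
    by_cases hj : j = C.o
    · rw [hj, C.w_o, smul_zero, smul_zero]
    · simp [z', hj]
  have hsplit : ∀ j, z' j = ((z' j).toNat : ℤ) - ((-z' j).toNat : ℤ) := fun j => by omega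
  refine ⟨fun j => (-z' j).toNat, fun j => (z' j).toNat, ?_, ?_⟩
  · have : (∑ j, ((z' j).toNat : ℤ)) - ∑ j, ((-z' j).toNat : ℤ) = 0 := by
      rw [← Finset.sum_sub_distrib, ← hz']
      exact Finset.sum_congr rfl fun j _ => (hsplit j).symm
    have h2 := (sub_eq_zero.mp this).symm
    exact_mod_cast h2
  · have : ∑ j, (z' j).toNat • C.w j - ∑ j, (-z' j).toNat • C.w j = a - b := by
      rw [← Finset.sum_sub_distrib, ← hw]
      refine Finset.sum_congr rfl fun j _ => ?_
      conv_rhs => rw [hsplit j]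
      rw [sub_smul, natCast_zsmul, natCast_zsmul]
    rw [sub_eq_sub_iff_add_eq_add] at this
    rw [← this, add_comm]

theorem prod_smul_torusPoint_pow (t : Torus 𝕜 (Fin n → ℤ)) (c : 𝕜) (k : κ → ℕ) :
    ∏ j, (c * monomialValue t (p • C.w j)) ^ k j =
      c ^ (∑ j, k j) * monomialValue t (∑ j, k j • C.w j) ^ p := by
  simp only [mul_pow, Finset.prod_mul_distrib, Finset.prod_pow_eq_pow_sum, monomialValue_sum,
    monomialValue_nsmul, ← Finset.prod_pow]
  congr 1
  exact Finset.prod_congr rfl fun j _ => by ring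

variable [Fintype ι]

/-- At a point with tangent space given by the torus point `t`, monomials of equal degree whose
exponents cannot be separated on the fiber group have proportional values. -/
theorem monomial_mul_eq [Infinite 𝕜] [CharP 𝕜 p] (hp : p.Prime) (hsep : C.Separates 𝕜) {x : ι → 𝕜}
    (hx : x ∈ affineCone (C.variety 𝕜)) (t : Torus 𝕜 (Fin n → ℤ))
    (h : C.yTangent x = Submodule.span 𝕜 {torusPoint (fun j => p • C.w j) t}) {m m' : ι →₀ ℕ}
    (hdeg : m.degree = m'.degree)
    (hmm' : ∀ s ∈ C.fiberGroup 𝕜,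
      monomialValue s (Finsupp.weight C.u m) = monomialValue s (Finsupp.weight C.u m')) :
    (m.prod fun i k => x i ^ k) * (monomialValue t (Finsupp.weight C.u m))⁻¹ =
      (m'.prod fun i k => x i ^ k) * (monomialValue t (Finsupp.weight C.u m'))⁻¹ := by
  have := Nonempty.intro C.o
  have : Fact p.Prime := ⟨hp⟩
  obtain ⟨k, l, hkl, hab⟩ := C.exists_sum_smul_eq (hsep _ _ hmm')
  obtain ⟨Q, a, ha, hQx, hQ⟩ := C.exists_polynomials_yTangent (torusPoint_ne_zero _ t) h
  -- On the torus, F m k is the p-th power of the character m + Σ k_j w_j up to scalars depending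
  -- only on the degrees of m and k. So F m k - F m' l is in the ideal, and its value at x gives the
  -- p-th power of the claim.
  let F (m : ι →₀ ℕ) (k : κ → ℕ) : MvPolynomial ι 𝕜 :=
    MvPolynomial.monomial m 1 ^ p * ∏ j, Q j ^ k j
  have hF : ∀ q m k, MvPolynomial.eval q (F m k) =
      (m.prod fun i e => q i ^ e) ^ p * ∏ j, MvPolynomial.eval q (Q j) ^ k j := fun q m k => by
    simp [F, MvPolynomial.eval_monomial]
  have hcone : ∀ (t' : Torus 𝕜 ((Fin n → ℤ) × ℤ)) (m : ι →₀ ℕ),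
      (m.prod fun i e => C.conePoint t' i ^ e) = monomialValue t' (0, 1) ^ m.degree *
        monomialValue (t'.comap (AddMonoidHom.inl _ ℤ)) (Finsupp.weight C.u m) := by
    intro t' m
    rw [← prod_torusPoint_pow, conePoint, torusPoint_coneExponent, Finsupp.prod, Finsupp.prod,
      Finsupp.degree_apply, ← Finset.prod_pow_eq_pow_sum, ← Finset.prod_mul_distrib]
    exact Finset.prod_congr rfl fun i _ => by rw [Pi.smul_apply, smul_eq_mul, mul_pow]
  have hmem : F m k - F m' l ∈ idealOf (C.variety 𝕜) := by
    rw [C.mem_idealOf_iff]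
    intro t'
    obtain ⟨b, hb⟩ := hQ t'
    have hb' : ∀ j, MvPolynomial.eval (C.conePoint t') (Q j) =
        b * monomialValue t' (0, 1) *
          monomialValue (t'.comap (AddMonoidHom.inl _ ℤ)) (p • C.w j) := fun j => by
      rw [hb, conePoint_inr_eq, mul_assoc]
      rfl
    have key : ∀ m k, MvPolynomial.eval (C.conePoint t') (F m k) =
        (monomialValue t' (0, 1) ^ m.degree) ^ p * (b * monomialValue t' (0, 1)) ^ (∑ j, k j) *
          monomialValue (t'.comap (AddMonoidHom.inl _ ℤ))
            (Finsupp.weight C.u m + ∑ j, k j • C.w j) ^ p := fun m k => by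
      rw [hF, hcone]
      simp only [hb', C.prod_smul_torusPoint_pow, monomialValue_add]
      ring
    rw [map_sub, key, key, hab, hdeg, hkl, sub_self]
  have h0 := C.eval_eq_zero hx hmem
  have hat : ∀ m k, MvPolynomial.eval x (F m k) =
      a ^ (∑ j, k j) * monomialValue t (Finsupp.weight C.u m + ∑ j, k j • C.w j) ^ p *
        ((m.prod fun i k => x i ^ k) * (monomialValue t (Finsupp.weight C.u m))⁻¹) ^ p := by
    intro m k
    have hne := monomialValue_ne_zero t (Finsupp.weight C.u m)
    rw [hF]
    simp only [hQx, torusPoint_apply, C.prod_smul_torusPoint_pow, monomialValue_add]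
    rw [← div_eq_mul_inv, div_pow, mul_pow]
    field_simp
  rw [map_sub, hat, hat, hab, hkl, ← mul_sub] at h0
  have h1 := (mul_eq_zero.mp h0).resolve_left
    (mul_ne_zero (pow_ne_zero _ ha) (pow_ne_zero _ (monomialValue_ne_zero _ _)))
  exact frobenius_inj 𝕜 p (sub_eq_zero.mp h1)

/-- A point whose tangent space is given by the torus point `t` lies in the closure of the
translate of the orbit of the fiber group by `t`. -/
theorem mem_closure_of_yTangent_eq [Infinite 𝕜] [CharP 𝕜 p] (hp : p.Prime)
    (hsep : C.Separates 𝕜) {P : ℙ 𝕜 (ι → 𝕜)} (hP : P ∈ C.variety 𝕜) (t : Torus 𝕜 (Fin n → ℤ))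
    (h : C.yTangent P.rep = Submodule.span 𝕜 {torusPoint (fun j => p • C.w j) t}) :
    P ∈ closure {R | ∃ s ∈ C.fiberGroup 𝕜, ∃ h : torusPoint C.u (t * s) ≠ 0,
      R = Projectivization.mk 𝕜 (torusPoint C.u (t * s)) h} := by
  have := C.nonempty
  rw [mem_closure_iff_forall_eval]
  intro G d hG hvan
  -- A form vanishing on the translate by t is a relation between characters restricted to the fiber
  -- group. By `monomial_mul_eq`, the monomials at P divided by those at t depend only on the
  -- restricted character, so they satisfy the same relation.
  have hrel := sum_mul_eq_zero_of_sum_characters_eq_zero G.support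
    (fun m => (torusCharacter 𝕜 (Finsupp.weight C.u m)).comp (C.fiberGroup 𝕜).subtype)
    (fun m => G.coeff m * monomialValue t (Finsupp.weight C.u m))
    (fun m => (m.prod fun i k => P.rep i ^ k) * (monomialValue t (Finsupp.weight C.u m))⁻¹)
    (fun s => by
      have h0 := hvan _ ⟨s.1, s.2, torusPoint_ne_zero _ _, rfl⟩
      rw [eval_rep_mk_eq_zero_iff hG, eval_torusPoint] at h0
      rw [← h0]
      refine Finset.sum_congr rfl fun m _ => ?_
      change _ * monomialValue s.1 _ = _ * monomialValue (t * s.1) _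
      rw [monomialValue_mul]
      ring)
    (fun m hm m' hm' hmm' => by
      refine C.monomial_mul_eq hp hsep (rep_mem_affineCone hP) t h ?_
        fun s hs => DFunLike.congr_fun hmm' (⟨s, hs⟩ : C.fiberGroup 𝕜)
      rw [Finsupp.degree_eq_weight_one]
      exact (hG (MvPolynomial.mem_support_iff.mp hm)).trans
        (hG (MvPolynomial.mem_support_iff.mp hm')).symm)
  rw [eval_eq_sum_prod, ← hrel]
  refine Finset.sum_congr rfl fun m _ => ?_
  have hne := monomialValue_ne_zero t (Finsupp.weight C.u m)
  field_simp

end GaussConfig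

/-! ### Orbits of subtori as the components of general fibers. -/

/-- The linear embedding repeats coordinates along f and rescales them by a; the translation by v
contributes only a common scalar. -/
theorem closure_image_smul_projectivelyEquivalent {𝕜 : Type*} [Field 𝕜] {N : Type*}
    [AddCommGroup N] {ι ι' : Type*} [Fintype ι] [Nonempty ι] [Finite ι'] (u : ι → N) (u' : ι' → N)
    (f : ι → ι') (hf : Function.Surjective f) (v : N) (hu : ∀ i, u i = u' (f i) - v) (a : ι → 𝕜)
    (ha : ∀ i, a i ≠ 0) :
    ProjectivelyEquivalent (closure {R | ∃ (s : Torus 𝕜 N) (h : a * torusPoint u s ≠ 0),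
      R = Projectivization.mk 𝕜 (a * torusPoint u s) h}) (closure (monomialImage 𝕜 u')) := by
  let J : (ι' → 𝕜) →ₗ[𝕜] (ι → 𝕜) := LinearMap.pi fun i => a i • LinearMap.proj (f i)
  have hJ : Function.Injective J := by
    rw [injective_iff_map_eq_zero]
    intro x hx
    funext k
    obtain ⟨i, rfl⟩ := hf k
    exact (mul_eq_zero.mp (congrFun hx i)).resolve_left (ha i)
  have hJt : ∀ s : Torus 𝕜 N,
      J (torusPoint u' s) = monomialValue s v • (a * torusPoint u s) := fun s => by
    funext i
    have hv := monomialValue_ne_zero s v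
    simp only [J, LinearMap.pi_apply, LinearMap.smul_apply, LinearMap.proj_apply, Pi.smul_apply,
      Pi.mul_apply, torusPoint_apply, hu, monomialValue_sub, smul_eq_mul]
    field_simp
  have hne : ∀ s : Torus 𝕜 N, a * torusPoint u s ≠ 0 := fun s h =>
    mul_ne_zero (ha (Classical.arbitrary ι)) (monomialValue_ne_zero s _)
      (congrFun h (Classical.arbitrary ι))
  have : Nonempty ι' := ⟨f (Classical.arbitrary ι)⟩
  refine (projectivelyEquivalent_of_map J hJ ?_).symm
  rw [← closure_image_map]
  congr 1
  ext R
  constructor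
  · rintro ⟨_, ⟨s, hs, rfl⟩, rfl⟩
    refine ⟨s, hne s, ?_⟩
    rw [Projectivization.map_mk, Projectivization.mk_eq_mk_iff']
    exact ⟨_, (hJt s).symm⟩
  · rintro ⟨s, hs, rfl⟩
    refine ⟨_, ⟨s, torusPoint_ne_zero _ _, rfl⟩, ?_⟩
    rw [Projectivization.map_mk, Projectivization.mk_eq_mk_iff']
    exact ⟨_, (hJt s).symm⟩

theorem ForGeneralGaussFiber.mono {𝕜 ι : Type*} [Field 𝕜] [Fintype ι] [LinearOrder ι]
    {X : Set (ℙ 𝕜 (ι → 𝕜))} {Q Q' : Set (ℙ 𝕜 (ι → 𝕜)) → Prop} (h : ForGeneralGaussFiber X Q)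
    (hQ : ∀ F, Q F → Q' F) : ForGeneralGaussFiber X Q' := by
  obtain ⟨U, hU, hne, h⟩ := h
  exact ⟨U, hU, hne, fun y hy => hQ _ (h y hy)⟩

namespace GaussConfig

variable {p n : ℕ} {ι κ : Type*} (C : GaussConfig p n ι κ) {𝕜 : Type*} [Field 𝕜]

/-- The orbit of the point `t` of `C.variety` under the subtorus given by `π`. -/
def subtorusOrbit {N : Type*} [AddCommGroup N] (π : (Fin n → ℤ) →+ N)
    (t : Torus 𝕜 (Fin n → ℤ)) : Set (ℙ 𝕜 (ι → 𝕜)) :=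
  {R | ∃ (s : Torus 𝕜 N) (h : torusPoint C.u t * torusPoint (fun i => π (C.u i)) s ≠ 0),
    R = Projectivization.mk 𝕜 (torusPoint C.u t * torusPoint (fun i => π (C.u i)) s) h}

theorem torusPoint_mul_comap {N : Type*} [AddCommGroup N] (π : (Fin n → ℤ) →+ N)
    (t : Torus 𝕜 (Fin n → ℤ)) (s : Torus 𝕜 N) :
    torusPoint C.u t * torusPoint (fun i => π (C.u i)) s = torusPoint C.u (t * s.comap π) := by
  funext i
  simp

theorem isIrreducible_subtorusOrbit [Infinite 𝕜] {N : Type*} [AddCommGroup N] [Module.Free ℤ N]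
    (π : (Fin n → ℤ) →+ N) (t : Torus 𝕜 (Fin n → ℤ)) : IsIrreducible (C.subtorusOrbit π t) := by
  have := C.nonempty
  have hne : ∀ s : Torus 𝕜 N, torusPoint C.u t * torusPoint (fun i => π (C.u i)) s ≠ 0 := fun s => by
    rw [torusPoint_mul_comap]
    exact torusPoint_ne_zero _ _
  convert isIrreducible_range_mk_torusPoint (fun i => π (C.u i)) (torusPoint C.u t) hne using 1
  ext R
  constructor
  · rintro ⟨s, hs, rfl⟩
    exact ⟨s, rfl⟩
  · rintro ⟨s, rfl⟩
    exact ⟨s, hne s, rfl⟩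

theorem isHomogeneous_signedMonomial (v : Fin n → ℤ) :
    (MvPolynomial.rename C.basicIndex (signedMonomial 𝕜 v)).IsHomogeneous
      (∑ i, (v i).toNat + ∑ i, (-v i).toNat) := by
  refine MvPolynomial.IsHomogeneous.rename_isHomogeneous ?_
  refine MvPolynomial.IsHomogeneous.mul ?_ (MvPolynomial.isHomogeneous_X_pow _ _)
  exact MvPolynomial.IsHomogeneous.prod _ _ _ fun i _ => MvPolynomial.isHomogeneous_X_pow _ _

/-- A torus point in the closure of the orbit of a subtorus lies in the orbit. -/
theorem monomialValue_eq_of_mem_closure {N : Type*} [AddCommGroup N] (π : (Fin n → ℤ) →+ N)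
    {t t' : Torus 𝕜 (Fin n → ℤ)} (ht' : torusPoint C.u t' ≠ 0)
    (h : Projectivization.mk 𝕜 (torusPoint C.u t') ht' ∈ closure (C.subtorusOrbit π t))
    {v : Fin n → ℤ} (hv : π v = 0) : monomialValue t' v = monomialValue t v := by
  let B : MvPolynomial ι 𝕜 := MvPolynomial.rename C.basicIndex (signedMonomial 𝕜 v) -
    MvPolynomial.C (monomialValue t v) *
      MvPolynomial.rename C.basicIndex (signedMonomial 𝕜 (-v))
  have hB : B.IsHomogeneous (∑ i, (v i).toNat + ∑ i, (-v i).toNat) := by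
    refine (C.isHomogeneous_signedMonomial v).sub ?_
    have h1 := (MvPolynomial.isHomogeneous_C ι (monomialValue t v)).mul
      (C.isHomogeneous_signedMonomial (𝕜 := 𝕜) (-v))
    simpa [add_comm] using h1
  have heval : ∀ t' : Torus 𝕜 (Fin n → ℤ), MvPolynomial.eval (torusPoint C.u t') B =
      (monomialValue t' v - monomialValue t v) * MvPolynomial.eval (torusPoint C.u t')
        (MvPolynomial.rename C.basicIndex (signedMonomial 𝕜 (-v))) := fun t' => by
    have h1 := C.eval_signedMonomial_eq (t'.comap (AddMonoidHom.fst _ ℤ)) v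
    rw [conePoint, torusPoint_coneExponent_comap] at h1
    rw [map_sub, map_mul, MvPolynomial.eval_C, h1, sub_mul]
    rfl
  have h0 := mem_closure_iff_forall_eval.mp h B _ hB (by
    rintro _ ⟨s, hs, rfl⟩
    rw [eval_rep_mk_eq_zero_iff hB, torusPoint_mul_comap, heval, monomialValue_mul,
      monomialValue_comap, hv, monomialValue_zero, mul_one, sub_self, zero_mul])
  rw [eval_rep_mk_eq_zero_iff hB, heval] at h0
  have h2 := C.eval_signedMonomial_ne_zero (t'.comap (AddMonoidHom.fst _ ℤ)) (-v)
  rw [conePoint, torusPoint_coneExponent_comap] at h2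
  exact sub_eq_zero.mp ((mul_eq_zero.mp h0).resolve_right h2)

variable [Fintype ι] [Fintype κ] [LinearOrder ι]

theorem gaussFiber_eq [Infinite 𝕜] [CharP 𝕜 p] {v : κ → 𝕜} (hv : v ≠ 0) :
    gaussFiber (C.variety 𝕜) (C.pluckerEmbedding (Projectivization.mk 𝕜 v hv)) =
      {P | P ∈ smoothLocus (C.variety 𝕜) ∧ C.yTangent P.rep = Submodule.span 𝕜 {v}} := by
  ext P
  constructor
  · rintro ⟨Q, hQ, rfl⟩
    exact ⟨Q.2, (C.gaussMap_eq_iff Q hv).mp hQ⟩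
  · rintro ⟨hP, h⟩
    exact ⟨⟨P, hP⟩, (C.gaussMap_eq_iff ⟨P, hP⟩ hv).mpr h, rfl⟩

/-- A general fiber of the Gauss map is a fiber over a torus point. -/
theorem forGeneralGaussFiber_of_torusPoint [Infinite 𝕜] [CharP 𝕜 p]
    (hclosed : ∀ v : κ → 𝕜, ∀ hv : v ≠ 0, (∀ j, v j ≠ 0) → Projectivization.mk 𝕜 v hv ∈
      closure (monomialImage 𝕜 fun j => p • C.w j) →
        Projectivization.mk 𝕜 v hv ∈ monomialImage 𝕜 fun j => p • C.w j)
    {Q : Set (ℙ 𝕜 (ι → 𝕜)) → Prop}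
    (hQ : ∀ t : Torus 𝕜 (Fin n → ℤ), Q {P | P ∈ smoothLocus (C.variety 𝕜) ∧
      C.yTangent P.rep = Submodule.span 𝕜 {torusPoint (fun j => p • C.w j) t}}) :
    ForGeneralGaussFiber (C.variety 𝕜) Q := by
  classical
  have := Nonempty.intro C.o
  obtain ⟨r, hr⟩ := (C.pluckerMap 𝕜 (C.coneDim_variety (𝕜 := 𝕜))).exists_leftInverse_of_injective
    (LinearMap.ker_eq_bot.mpr (C.pluckerMap_injective _))
  -- These linear forms on the Plücker space read off the coordinates y_j; the open set is where
  -- none of them vanishes.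
  let L (j : κ) := linearPullback r (MvPolynomial.X j)
  have hL : ∀ j, (L j).IsHomogeneous 1 := fun j =>
    isHomogeneous_linearPullback r (MvPolynomial.isHomogeneous_X 𝕜 j)
  have hmem : ∀ (v : κ → 𝕜) (hv : v ≠ 0) j, MvPolynomial.eval
      (C.pluckerEmbedding (Projectivization.mk 𝕜 v hv)).rep (L j) = 0 ↔ v j = 0 := by
    intro v hv j
    rw [pluckerEmbedding, Projectivization.map_mk, eval_rep_mk_eq_zero_iff (hL j),
      eval_linearPullback, MvPolynomial.eval_X]
    rw [show r (C.pluckerMap 𝕜 C.coneDim_variety v) = v from LinearMap.congr_fun hr v]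
  refine ⟨⋂ j, {y | MvPolynomial.eval y.rep (L j) = 0}ᶜ,
    isOpen_iInter_of_finite fun j => (isClosed_zeroLocus (hL j)).isOpen_compl, ?_, ?_⟩
  · refine ⟨C.pluckerEmbedding (Projectivization.mk 𝕜 _
      (torusPoint_ne_zero (fun j => p • C.w j) (1 : Torus 𝕜 (Fin n → ℤ)))), ?_, ?_⟩
    · rw [Set.mem_iInter]
      intro j
      rw [Set.mem_compl_iff, Set.mem_ofPred, hmem]
      exact monomialValue_ne_zero _ _
    · rw [C.gaussImage_variety]
      exact ⟨_, subset_closure ⟨1, torusPoint_ne_zero _ _, rfl⟩, rfl⟩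
  · rintro y ⟨hyU, hy⟩
    rw [C.gaussImage_variety] at hy
    obtain ⟨P, hP, rfl⟩ := hy
    induction P using Projectivization.ind with
    | h v hv =>
    rw [Set.mem_iInter] at hyU
    have hv0 : ∀ j, v j ≠ 0 := fun j => by
      have hj := hyU j
      rwa [Set.mem_compl_iff, Set.mem_ofPred, hmem] at hj
    obtain ⟨t, ht, hvt⟩ := hclosed v hv hv0 hP
    rw [hvt, C.gaussFiber_eq]
    exact hQ t

/-- The structure of a general fiber of the Gauss map: if the fiber group is a disjoint union of
cosets `ζ k * π^* T_N`, then the closures of the orbits of `π^* T_N` are the irreducible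
components. -/
theorem forGeneralGaussFiber_orbits [Infinite 𝕜] [CharP 𝕜 p] (hp : p.Prime)
    (hsep : C.Separates 𝕜)
    (hclosed : ∀ v : κ → 𝕜, ∀ hv : v ≠ 0, (∀ j, v j ≠ 0) → Projectivization.mk 𝕜 v hv ∈
      closure (monomialImage 𝕜 fun j => p • C.w j) →
        Projectivization.mk 𝕜 v hv ∈ monomialImage 𝕜 fun j => p • C.w j)
    {N : Type*} [AddCommGroup N] [Module.Free ℤ N] (π : (Fin n → ℤ) →+ N)
    (g : N →+ (Fin n → ℤ)) (hg : ∀ x, π (g x) = x) (hπ : ∀ j, π (p • C.w j) = 0)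
    {K : Type*} [Finite K] (ζ : K → Torus 𝕜 (Fin n → ℤ)) (hζ : ∀ k, ζ k ∈ C.fiberGroup 𝕜)
    (hcover : ∀ h ∈ C.fiberGroup 𝕜, ∃ k, ∃ s : Torus 𝕜 N, h = ζ k * s.comap π)
    (hdisj : ∀ k l, ∀ s : Torus 𝕜 N, ζ l = ζ k * s.comap π → k = l) :
    ForGeneralGaussFiber (C.variety 𝕜) fun F => ∃ t : K → Torus 𝕜 (Fin n → ℤ),
      (∀ k, C.subtorusOrbit π (t k) ⊆ F) ∧ F ⊆ ⋃ k, closure (C.subtorusOrbit π (t k)) ∧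
      ∀ k l, C.subtorusOrbit π (t l) ⊆ closure (C.subtorusOrbit π (t k)) → k = l := by
  have := C.nonempty
  have hπs : ∀ s : Torus 𝕜 N, s.comap π ∈ C.fiberGroup 𝕜 := fun s j => by
    rw [monomialValue_comap, hπ, monomialValue_zero]
  refine C.forGeneralGaussFiber_of_torusPoint hclosed fun t => ⟨fun k => t * ζ k, ?_, ?_, ?_⟩
  · rintro k _ ⟨s, hs, rfl⟩
    simp only [torusPoint_mul_comap]
    refine ⟨C.monomialImage_subset_smoothLocus ⟨_, torusPoint_ne_zero _ _, rfl⟩, ?_⟩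
    rw [C.yTangent_rep_mk]
    congr 2
    funext j
    have h1 := (C.fiberGroup 𝕜).mul_mem (hζ k) (hπs s) j
    rw [monomialValue_mul] at h1
    rw [torusPoint_apply, monomialValue_mul, monomialValue_mul, mul_assoc, h1, mul_one,
      torusPoint_apply]
  · rintro P ⟨hP, h⟩
    rw [← closure_iUnion_of_finite]
    refine closure_mono ?_ (C.mem_closure_of_yTangent_eq hp hsep hP.1 t h)
    rintro _ ⟨s, hs, hne, rfl⟩
    obtain ⟨k, s', rfl⟩ := hcover s hs
    refine Set.mem_iUnion.mpr ⟨k, s', ?_, ?_⟩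
    · rw [torusPoint_mul_comap]
      exact torusPoint_ne_zero _ _
    · congr 1
      funext i
      simp [mul_assoc]
  · intro k l hle
    have hl : Projectivization.mk 𝕜 (torusPoint C.u (t * ζ l)) (torusPoint_ne_zero _ _) ∈
        C.subtorusOrbit π (t * ζ l) := by
      refine ⟨1, ?_, ?_⟩
      · rw [torusPoint_mul_comap]
        exact torusPoint_ne_zero _ _
      · congr 1
        funext i
        simp
    have hval : ∀ v, π v = 0 → monomialValue (ζ l) v = monomialValue (ζ k) v := fun v hv => by
      have h1 := C.monomialValue_eq_of_mem_closure π _ (hle hl) hv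
      rw [monomialValue_mul, monomialValue_mul] at h1
      exact mul_left_cancel₀ (monomialValue_ne_zero t v) h1
    -- The points ζ k and ζ l agree on the kernel of π, so their quotient factors through π; the
    -- factor is its pullback along the section g.
    refine hdisj k l (((ζ k)⁻¹ * ζ l).comap g) (torus_ext fun u => ?_)
    have hu := hval (u - g (π u)) (by rw [map_sub, hg, sub_self])
    rw [monomialValue_sub, monomialValue_sub] at hu
    simp only [monomialValue_mul, monomialValue_comap, monomialValue_inv]
    have h1 := monomialValue_ne_zero (ζ k) (g (π u))
    have h2 := monomialValue_ne_zero (ζ l) (g (π u))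
    field_simp at hu ⊢
    linear_combination hu

end GaussConfig

/-! ### Points of a toric variety with nonzero coordinates. -/

section Reconstruction

variable {M : Type*} [AddCommGroup M]

theorem exists_sum_smul_sub_eq {κ : Type*} [Fintype κ] {u : κ → M}
    (hu : affineSpan ℤ (Set.range u) = ⊤) (o : κ) (x : M) :
    ∃ z : κ → ℤ, ∑ j, z j • (u j - u o) = x := by
  classical
  suffices h : ∀ y : M, y - u o ∈ Submodule.span ℤ (Set.range fun j => u j - u o) by
    have := h (x + u o)
    rw [add_sub_cancel_right] at this
    exact (Submodule.mem_span_range_iff_exists_fun ℤ).mp this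
  intro y
  have hy : y ∈ affineSpan ℤ (Set.range u) := hu ▸ trivial
  refine affineSpan_induction (p := fun y => y - u o ∈
    Submodule.span ℤ (Set.range fun j => u j - u o)) hy ?_ ?_
  · rintro _ ⟨j, rfl⟩
    exact Submodule.subset_span ⟨j, rfl⟩
  · intro c a b d ha hb hd
    have : (c • (a -ᵥ b) +ᵥ d) - u o = c • ((a - u o) - (b - u o)) + (d - u o) := by
      rw [vsub_eq_sub, vadd_eq_add, sub_sub_sub_cancel_right, add_sub_assoc]
    rw [this]
    exact Submodule.add_mem _ (Submodule.smul_mem _ _ (Submodule.sub_mem _ ha hb)) hd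

theorem prod_torusPoint_pow_eq {𝕜 κ : Type*} [Field 𝕜] [Fintype κ] (u : κ → M) (t : Torus 𝕜 M)
    (k : κ → ℕ) : ∏ j, torusPoint u t j ^ k j = monomialValue t (∑ j, k j • u j) := by
  rw [monomialValue_sum]
  exact Finset.prod_congr rfl fun j _ => (monomialValue_nsmul t _ _).symm

/-- The points of a projective toric variety with nonzero coordinates lie in the image of the
torus if the exponents generate the lattice affinely. -/
theorem mk_mem_monomialImage_of_mem_closure {𝕜 κ : Type*} [Field 𝕜] [Fintype κ]
    [Module.Free ℤ M] {u : κ → M}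
    (hu : affineSpan ℤ (Set.range u) = ⊤) (o : κ) {v : κ → 𝕜} (hv : v ≠ 0) (hv0 : ∀ j, v j ≠ 0)
    (h : Projectivization.mk 𝕜 v hv ∈ closure (monomialImage 𝕜 u)) :
    Projectivization.mk 𝕜 v hv ∈ monomialImage 𝕜 u := by
  classical
  obtain ⟨τ, hτ⟩ := exists_torus_basis (Pi.basisFun ℤ κ) fun j => Units.mk0 (v j) (hv0 j)
  have hτv : torusPoint (fun j => Pi.single j 1) τ = v := by
    funext j
    simpa using hτ j
  let ψ : (κ → ℤ) →ₗ[ℤ] M × ℤ := (Pi.basisFun ℤ κ).constr ℤ (coneExponent u)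
  have hψ : ∀ j, ψ (Pi.single j 1) = (u j, 1) := fun j => by
    have h1 := (Pi.basisFun ℤ κ).constr_basis ℤ (coneExponent u) j
    rw [Pi.basisFun_apply] at h1
    exact h1
  have hsum : ∀ z : κ → ℤ, z = ∑ j, z j • (Pi.single j 1 : κ → ℤ) := fun z => by
    conv_lhs => rw [pi_eq_sum_univ' z]
  -- Each z in the kernel of ψ gives a homogeneous binomial that vanishes on the toric variety; at v
  -- it says that τ is trivial on z.
  have hker : ∀ z, ψ z = 0 → monomialValue τ z = 1 := by
    intro z hz
    let k (j : κ) : ℕ := (z j).toNat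
    let l (j : κ) : ℕ := (-z j).toNat
    have hzkl : ∑ j, k j • (Pi.single j 1 : κ → ℤ) = z + ∑ j, l j • (Pi.single j 1 : κ → ℤ) := by
      conv_rhs => rw [hsum z, ← Finset.sum_add_distrib]
      refine Finset.sum_congr rfl fun j _ => ?_
      rw [← natCast_zsmul, ← natCast_zsmul, ← add_smul]
      congr 1
      simp only [k, l]
      omega
    have hψkl := congrArg ψ hzkl
    rw [map_add, hz, zero_add, map_sum, map_sum] at hψkl
    simp only [map_nsmul, hψ] at hψkl
    have h1 : ∑ j, k j • u j = ∑ j, l j • u j := by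
      simpa [Prod.fst_sum] using congrArg Prod.fst hψkl
    have h2 : ∑ j, k j = ∑ j, l j := by
      have := congrArg Prod.snd hψkl
      simp only [Prod.snd_sum, Prod.smul_mk, nsmul_eq_mul, mul_one] at this
      exact_mod_cast this
    have hhom : ∀ k : κ → ℕ, (∏ j, (MvPolynomial.X j : MvPolynomial κ 𝕜) ^ k j).IsHomogeneous
        (∑ j, k j) := fun k =>
      MvPolynomial.IsHomogeneous.prod _ _ _ fun j _ => MvPolynomial.isHomogeneous_X_pow _ _
    have hB := (hhom k).sub (h2 ▸ hhom l)
    have h0 := mem_closure_iff_forall_eval.mp h _ _ hB (by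
      rintro _ ⟨t, ht, rfl⟩
      rw [eval_rep_mk_eq_zero_iff hB]
      simp only [map_sub, map_prod, map_pow, MvPolynomial.eval_X, prod_torusPoint_pow_eq, h1,
        sub_self])
    rw [eval_rep_mk_eq_zero_iff hB, ← hτv] at h0
    simp only [map_sub, map_prod, map_pow, MvPolynomial.eval_X, prod_torusPoint_pow_eq] at h0
    rw [hzkl, monomialValue_add, sub_eq_zero] at h0
    exact mul_right_cancel₀ (monomialValue_ne_zero _ _) (h0.trans (one_mul _).symm)
  have hsurj : Function.Surjective ψ := by
    rintro ⟨x, d⟩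
    obtain ⟨z, hz⟩ := exists_sum_smul_sub_eq hu o (x - d • u o)
    refine ⟨∑ j, z j • ((Pi.single j 1 : κ → ℤ) - Pi.single o 1) + d • Pi.single o 1, ?_⟩
    simp only [map_add, map_sum, map_zsmul, map_sub, hψ, Prod.mk_sub_mk, sub_self]
    refine Prod.ext ?_ ?_
    · simp only [Prod.fst_add, Prod.fst_sum, Prod.smul_mk]
      rw [hz, sub_add_cancel]
    · simp [Prod.snd_sum]
  -- Since τ is trivial on the kernel, composing it with a section of ψ descends it to the torus of
  -- M × ℤ.
  obtain ⟨g, hg⟩ := Module.projective_lifting_property ψ LinearMap.id hsurj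
  have hgψ : ∀ y, ψ (g y) = y := fun y => LinearMap.congr_fun hg y
  let t : Torus 𝕜 (M × ℤ) := τ.comap g.toAddMonoidHom
  have ht : torusPoint (coneExponent u) t = v := by
    funext j
    have h1 := hker (g (u j, 1) - Pi.single j 1) (by rw [map_sub, hgψ, hψ, sub_self])
    rw [monomialValue_sub, mul_inv_eq_one₀ (monomialValue_ne_zero _ _)] at h1
    rw [← hτv]
    exact h1
  rw [torusPoint_coneExponent] at ht
  have := Nonempty.intro o
  refine ⟨t.comap (AddMonoidHom.inl M ℤ), torusPoint_ne_zero _ _, ?_⟩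
  rw [Projectivization.mk_eq_mk_iff']
  exact ⟨_, ht⟩

theorem torus_ext_basis {𝕜 β : Type*} [Field 𝕜] (b : Module.Basis β ℤ M) {s t : Torus 𝕜 M}
    (h : ∀ i, monomialValue s (b i) = monomialValue t (b i)) : s = t := by
  refine torus_ext fun u => ?_
  rw [← b.linearCombination_repr u, Finsupp.linearCombination_apply, Finsupp.sum,
    monomialValue_sum, monomialValue_sum]
  exact Finset.prod_congr rfl fun i _ => by rw [monomialValue_zsmul, monomialValue_zsmul, h]

end Reconstruction

/-! ### Splittings and generators of lattices. -/

section Lattice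

/-- A surjection from a free abelian group to a free abelian group splits off a complement of the
expected rank. -/
theorem exists_equiv_prod_of_surjective {Λ M' M'' : Type*} [AddCommGroup Λ] [Module.Free ℤ Λ]
    [Module.Finite ℤ Λ] [AddCommGroup M'] [Module.Free ℤ M'] [Module.Finite ℤ M']
    [AddCommGroup M''] [Module.Free ℤ M''] [Module.Finite ℤ M'']
    (hrank : Module.finrank ℤ Λ = Module.finrank ℤ M' + Module.finrank ℤ M'')
    (π : Λ →ₗ[ℤ] M') (hπ : Function.Surjective π) :
    ∃ E : Λ ≃ₗ[ℤ] M' × M'', ∀ a, (E a).1 = π a := by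
  obtain ⟨g, hg⟩ := Module.projective_lifting_property π LinearMap.id hπ
  have hgπ : ∀ y, π (g y) = y := fun y => LinearMap.congr_fun hg y
  let e : Λ ≃ₗ[ℤ] M' × LinearMap.ker π :=
    { toFun := fun a => (π a, ⟨a - g (π a), by simp [hgπ]⟩)
      invFun := fun x => g x.1 + x.2
      map_add' := fun a b => by
        refine Prod.ext (map_add π a b) (Subtype.ext ?_)
        simp only [map_add, Submodule.coe_add, Prod.snd_add]
        abel
      map_smul' := fun k a => by
        refine Prod.ext (map_zsmul π k a) (Subtype.ext ?_)
        simp [smul_sub]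
      left_inv := fun a => by simp
      right_inv := fun x => by
        have hx : π (x.2 : Λ) = 0 := x.2.2
        refine Prod.ext ?_ (Subtype.ext ?_)
        · simp [hgπ, hx]
        · simp [hgπ, hx] }
  have hfin : Module.finrank ℤ (LinearMap.ker π) = Module.finrank ℤ M'' := by
    have h1 := e.finrank_eq
    rw [Module.finrank_prod] at h1
    omega
  exact ⟨e ≪≫ₗ (LinearEquiv.refl ℤ M').prodCongr (LinearEquiv.ofFinrankEq _ _ hfin), fun a => rfl⟩

/-- The q_i are the future images of the n basis vectors. They enumerate A - o without 0, and
superfluous indices get the value 0; the bound on the cardinality of A is what makes this possible.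
-/
theorem exists_fun_range_eq {M : Type*} [AddCommGroup M] (A : Finset M) {n : ℕ}
    (hA : A.card ≤ n + 1) {o : M} (ho : o ∈ A) :
    ∃ q : Fin n → M, (∀ i, q i + o ∈ A) ∧ ∀ a ∈ A, a = o ∨ ∃ i, a = q i + o := by
  classical
  have hcard : Fintype.card (A.erase o) ≤ Fintype.card (Fin n) := by
    rw [Fintype.card_coe, Finset.card_erase_of_mem ho, Fintype.card_fin]
    omega
  obtain ⟨f⟩ := Function.Embedding.nonempty_of_card_le hcard
  refine ⟨Function.extend f (fun b => (b : M) - o) 0, fun i => ?_, fun a ha => ?_⟩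
  · by_cases hi : ∃ b, f b = i
    · obtain ⟨b, rfl⟩ := hi
      rw [f.injective.extend_apply, sub_add_cancel]
      exact Finset.mem_of_mem_erase b.2
    · rw [Function.extend_apply' _ _ _ hi, Pi.zero_apply, zero_add]
      exact ho
  · by_cases hao : a = o
    · exact Or.inl hao
    · refine Or.inr ⟨f ⟨a, Finset.mem_erase.mpr ⟨hao, ha⟩⟩, ?_⟩
      rw [f.injective.extend_apply, sub_add_cancel]

theorem range_enum {M : Type*} [AddCommGroup M] (A : Finset M) : Set.range (enum A) = A := by
  ext a
  constructor
  · rintro ⟨i, rfl⟩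
    exact (A.equivFin.symm i).2
  · intro ha
    exact ⟨A.equivFin ⟨a, ha⟩, by simp [enum]⟩

theorem enum_injective {M : Type*} [AddCommGroup M] (A : Finset M) :
    Function.Injective (enum A) :=
  Subtype.val_injective.comp A.equivFin.symm.injective

theorem affineSpan_eq_top_of_single_mem {n : ℕ} {S : Set (Fin n → ℤ)} (h0 : (0 : Fin n → ℤ) ∈ S)
    (h : ∀ i, Pi.single i 1 ∈ S) : affineSpan ℤ S = ⊤ := by
  rw [eq_top_iff]
  rintro z -
  let V : Submodule ℤ (Fin n → ℤ) :=
    { carrier := affineSpan ℤ S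
      zero_mem' := subset_affineSpan ℤ S h0
      add_mem' := fun {a b} ha hb => by
        have := (affineSpan ℤ S).smul_vsub_vadd_mem 1 ha (subset_affineSpan ℤ S h0) hb
        simpa using this
      smul_mem' := fun k a ha => by
        have := (affineSpan ℤ S).smul_vsub_vadd_mem k ha (subset_affineSpan ℤ S h0)
          (subset_affineSpan ℤ S h0)
        simpa using this }
  have hz : z ∈ V := by
    rw [pi_eq_sum_univ' z]
    exact Submodule.sum_mem _ fun i _ => V.smul_mem _ (subset_affineSpan ℤ S (h i))
  exact hz

end Lattice

/-! ### An endomorphism with cyclic cokernel of order |c| for c ≠ 0. -/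

section Scaling

variable {M : Type*} [AddCommGroup M] {β : Type*}

/-- The endomorphism that multiplies the basis vector `b i₀` by `c` and fixes the other basis
vectors. -/
noncomputable def scaleBasis (b : Module.Basis β ℤ M) (i₀ : β) (c : ℤ) : M →ₗ[ℤ] M :=
  LinearMap.id + (c - 1) • (b.coord i₀).smulRight (b i₀)

theorem scaleBasis_apply (b : Module.Basis β ℤ M) (i₀ : β) (c : ℤ) (x : M) :
    scaleBasis b i₀ c x = x + ((c - 1) * b.coord i₀ x) • b i₀ := by
  rw [mul_smul]
  rfl

theorem coord_scaleBasis (b : Module.Basis β ℤ M) (i₀ : β) (c : ℤ) (x : M) :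
    b.coord i₀ (scaleBasis b i₀ c x) = c * b.coord i₀ x := by
  simp [scaleBasis_apply]
  ring

theorem scaleBasis_self (b : Module.Basis β ℤ M) (i₀ : β) (c : ℤ) :
    scaleBasis b i₀ c (b i₀) = c • b i₀ := by
  simp [scaleBasis_apply, sub_smul]

theorem scaleBasis_of_ne (b : Module.Basis β ℤ M) {i₀ i : β} (hi : i ≠ i₀) (c : ℤ) :
    scaleBasis b i₀ c (b i) = b i := by
  simp [scaleBasis_apply, hi]

theorem scaleBasis_injective (b : Module.Basis β ℤ M) (i₀ : β) {c : ℤ} (hc : c ≠ 0) :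
    Function.Injective (scaleBasis b i₀ c) := by
  rw [injective_iff_map_eq_zero]
  intro x hx
  have h1 := coord_scaleBasis b i₀ c x
  rw [hx, map_zero, eq_comm, mul_eq_zero] at h1
  rw [scaleBasis_apply, h1.resolve_left hc] at hx
  simpa using hx

theorem exists_scaleBasis_eq (b : Module.Basis β ℤ M) (i₀ : β) {c : ℤ} {y : M}
    (hy : c ∣ b.coord i₀ y) : ∃ x, scaleBasis b i₀ c x = y := by
  obtain ⟨d, hd⟩ := hy
  -- This replaces the coordinate c d of y at b i₀ by d.
  refine ⟨y + (d - c * d) • b i₀, ?_⟩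
  rw [map_add, map_zsmul, scaleBasis_self, scaleBasis_apply, hd, add_assoc, smul_smul, ← add_smul]
  have : (c - 1) * (c * d) + (d - c * d) * c = 0 := by ring
  rw [this, zero_smul, add_zero]

end Scaling

/-! ### The fiber group and the image for the scaled exponents. -/

section SplitLattice

variable {𝕜 : Type*} [Field 𝕜] {p n : ℕ} {ι κ : Type*} (C : GaussConfig p n ι κ)
  {M' M'' β : Type*} [AddCommGroup M'] [AddCommGroup M''] (E : (Fin n → ℤ) ≃ₗ[ℤ] M' × M'')
  (b : Module.Basis β ℤ M'') (i₀ : β) (c : ℕ) (u : κ → M'')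

theorem monomialValue_equiv_prod (h : Torus 𝕜 (Fin n → ℤ)) (a : Fin n → ℤ) :
    monomialValue h a = monomialValue h (E.symm ((E a).1, 0)) *
      monomialValue h (E.symm (0, (E a).2)) := by
  rw [← monomialValue_add, ← map_add]
  simp

/-- The point of the torus whose value is `ω` to the power of the coordinate at `b i₀` of the
second component. -/
noncomputable def rootTwist (ω : 𝕜ˣ) : Torus 𝕜 (Fin n → ℤ) :=
  Torus.comap ((b.coord i₀).comp (LinearMap.snd ℤ M' M'' ∘ₗ E.toLinearMap)).toAddMonoidHom
    (zpowersHom 𝕜ˣ ω)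

theorem monomialValue_rootTwist (ω : 𝕜ˣ) (a : Fin n → ℤ) :
    monomialValue (rootTwist E b i₀ ω) a = (ω : 𝕜) ^ (b.coord i₀ (E a).2) := by
  simp [rootTwist, monomialValue, Torus.comap]

/-- The exponents `w j` are the images of the vectors `u j - u o` under the endomorphism
`scaleBasis b i₀ c` and the inclusion of `M''` as a direct summand of the lattice. -/
def GaussConfig.IsScaling : Prop :=
  ∀ j, C.w j = E.symm (0, scaleBasis b i₀ c (u j - u C.o))

variable {C E b i₀ c u}

theorem sum_zsmul_w [Fintype κ] (hw : C.IsScaling E b i₀ c u) (z : κ → ℤ) :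
    ∑ j, z j • C.w j = E.symm (0, scaleBasis b i₀ c (∑ j, z j • (u j - u C.o))) := by
  let f : M'' →ₗ[ℤ] (Fin n → ℤ) :=
    E.symm.toLinearMap ∘ₗ LinearMap.inr ℤ M' M'' ∘ₗ scaleBasis b i₀ c
  change _ = f (∑ j, z j • (u j - u C.o))
  rw [map_sum]
  refine Finset.sum_congr rfl fun j _ => ?_
  rw [map_zsmul, hw j]
  rfl

/-- The w_j generate the image of `scaleBasis` in the second summand, and h is trivial on each w_j
because it is trivial on p w_j and Frobenius is injective. -/
theorem monomialValue_scaleBasis [Fintype κ] [CharP 𝕜 p]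
    (hw : C.IsScaling E b i₀ c u) (hp : p.Prime)
    (hu : affineSpan ℤ (Set.range u) = ⊤) {h : Torus 𝕜 (Fin n → ℤ)} (hh : h ∈ C.fiberGroup 𝕜)
    (x : M'') : monomialValue h (E.symm (0, scaleBasis b i₀ c x)) = 1 := by
  have : Fact p.Prime := ⟨hp⟩
  obtain ⟨z, rfl⟩ := exists_sum_smul_sub_eq hu C.o x
  rw [← sum_zsmul_w hw, monomialValue_sum]
  refine Finset.prod_eq_one fun j _ => ?_
  have h1 : monomialValue h (C.w j) = 1 := frobenius_inj 𝕜 p (by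
    rw [frobenius_def, frobenius_def, one_pow, ← monomialValue_nsmul]
    exact hh j)
  rw [monomialValue_zsmul, h1, one_zpow]

theorem rootTwist_mem_fiberGroup
    (hw : C.IsScaling E b i₀ c u) {ω : 𝕜ˣ} (hω : ω ^ c = 1) :
    rootTwist E b i₀ ω ∈ C.fiberGroup 𝕜 := by
  intro j
  rw [monomialValue_nsmul, monomialValue_rootTwist, hw j, E.apply_symm_apply, coord_scaleBasis,
    zpow_mul, zpow_natCast, ← Units.val_pow_eq_pow_val, hω, Units.val_one, one_zpow, one_pow]

theorem comap_fst_mem_fiberGroup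
    (hw : C.IsScaling E b i₀ c u) (s : Torus 𝕜 M') :
    s.comap (LinearMap.fst ℤ M' M'' ∘ₗ E.toLinearMap).toAddMonoidHom ∈ C.fiberGroup 𝕜 := by
  intro j
  rw [monomialValue_nsmul, monomialValue_comap]
  simp [hw j]

/-- Restricted to M'', h is trivial on b i for i ≠ i₀ and on c b i₀, so this restriction is given by
a c-th root of unity; the restriction to M' is free. -/
theorem exists_eq_rootTwist_mul_comap [Fintype κ] [CharP 𝕜 p]
    (hw : C.IsScaling E b i₀ c u) (hp : p.Prime)
    (hu : affineSpan ℤ (Set.range u) = ⊤) {h : Torus 𝕜 (Fin n → ℤ)} (hh : h ∈ C.fiberGroup 𝕜) :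
    ∃ ω : 𝕜ˣ, ω ^ c = 1 ∧ ∃ s : Torus 𝕜 M', h = rootTwist E b i₀ ω *
      s.comap (LinearMap.fst ℤ M' M'' ∘ₗ E.toLinearMap).toAddMonoidHom := by
  have h1 := monomialValue_scaleBasis hw hp hu hh
  let η : Torus 𝕜 M'' := h.comap (E.symm.toLinearMap ∘ₗ LinearMap.inr ℤ M' M'').toAddMonoidHom
  let ω : 𝕜ˣ := η (Multiplicative.ofAdd (b i₀))
  have hωη : monomialValue η (b i₀) = ω := rfl
  have hη : ∀ x, monomialValue η (scaleBasis b i₀ c x) = 1 := h1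
  have hηω : η = Torus.comap (b.coord i₀).toAddMonoidHom (zpowersHom 𝕜ˣ ω) := by
    refine torus_ext_basis b fun i => ?_
    by_cases hi : i = i₀
    · subst hi
      rw [hωη]
      simp [monomialValue, Torus.comap]
    · have h2 := hη (b i)
      rw [scaleBasis_of_ne b hi] at h2
      rw [h2]
      simp [monomialValue, Torus.comap, hi]
  refine ⟨ω, ?_, h.comap (E.symm.toLinearMap ∘ₗ LinearMap.inl ℤ M' M'').toAddMonoidHom, ?_⟩
  · have h2 := hη (b i₀)
    rw [scaleBasis_self, monomialValue_zsmul, hωη, zpow_natCast] at h2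
    exact Units.ext (by simpa using h2)
  · refine torus_ext fun a => ?_
    rw [monomialValue_equiv_prod E h a, monomialValue_mul, monomialValue_rootTwist, mul_comm]
    congr 1
    change monomialValue η (E a).2 = _
    rw [hηω]
    simp [monomialValue, Torus.comap]

theorem eq_of_rootTwist_eq_mul_comap {ω ω' : 𝕜ˣ} {s : Torus 𝕜 M'}
    (h : rootTwist E b i₀ ω' = rootTwist E b i₀ ω *
      s.comap (LinearMap.fst ℤ M' M'' ∘ₗ E.toLinearMap).toAddMonoidHom) : ω = ω' := by
  have h1 := congrArg (fun t => monomialValue t (E.symm (0, b i₀))) h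
  simp only [monomialValue_mul, monomialValue_rootTwist, monomialValue_comap] at h1
  simp at h1
  exact (Units.ext h1).symm

/-- Testing a - a' on the torus of M' kills its first component. Testing on a primitive c-th root of
unity, which exists because c is coprime to p, makes the coordinate at b i₀ divisible by c; so a -
a' is in the lattice of the w_j. -/
theorem separates [Fintype κ] [IsAlgClosed 𝕜] [CharP 𝕜 p] [Module.Free ℤ M']
    (hw : C.IsScaling E b i₀ c u)
    (hcp : Nat.Coprime c p) (hc : 0 < c) (hp : p.Prime) (hu : affineSpan ℤ (Set.range u) = ⊤) :
    C.Separates 𝕜 := by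
  intro a a' haa'
  have : NeZero (c : 𝕜) := ⟨fun h0 => by
    rw [CharP.cast_eq_zero_iff 𝕜 p] at h0
    exact hp.one_lt.ne' (Nat.eq_one_of_dvd_coprimes hcp h0 dvd_rfl)⟩
  have : NeZero c := ⟨hc.ne'⟩
  have hval : ∀ h ∈ C.fiberGroup 𝕜, monomialValue h (a - a') = 1 := fun h hh => by
    rw [monomialValue_sub, haa' h hh, mul_inv_cancel₀ (monomialValue_ne_zero _ _)]
  have hfst : (E (a - a')).1 = 0 := by
    refine torusCharacter_injective (𝕜 := 𝕜) (MonoidHom.ext fun s => ?_)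
    have h1 := hval _ (comap_fst_mem_fiberGroup hw s)
    rw [monomialValue_comap] at h1
    exact h1.trans (monomialValue_zero s).symm
  obtain ⟨ω, hω⟩ := HasEnoughRootsOfUnity.exists_primitiveRoot 𝕜 c
  have hω0 : ω ≠ 0 := hω.ne_zero hc.ne'
  have hdvd : (c : ℤ) ∣ b.coord i₀ (E (a - a')).2 := by
    have h1 := hval _ (rootTwist_mem_fiberGroup hw (ω := Units.mk0 ω hω0)
      (Units.ext (by simpa using hω.pow_eq_one)))
    rw [monomialValue_rootTwist] at h1
    exact (hω.zpow_eq_one_iff_dvd _).mp h1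
  obtain ⟨x, hx⟩ := exists_scaleBasis_eq b i₀ hdvd
  obtain ⟨z, hz⟩ := exists_sum_smul_sub_eq hu C.o x
  refine ⟨z, ?_⟩
  rw [finsum_eq_sum_of_fintype, sum_zsmul_w hw, hz, hx, ← hfst]
  exact (E.symm_apply_apply (a - a')).symm

/-- Pulling back along p times `scaleBasis` is surjective on points of the torus of M'': on the
basis it takes powers with positive exponents p or p c, and roots exist in 𝕜. The translation by u_o
is a common scalar. -/
theorem monomialImage_smul_w_eq [IsAlgClosed 𝕜]
    (hw : C.IsScaling E b i₀ c u) (hp : 0 < p) (hc : 0 < c) :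
    monomialImage 𝕜 (fun j => p • C.w j) = monomialImage 𝕜 u := by
  have := Nonempty.intro C.o
  have key : ∀ (t : Torus 𝕜 (Fin n → ℤ)) (χ : Torus 𝕜 M''),
      (∀ x, monomialValue t (p • E.symm (0, scaleBasis b i₀ c x)) = monomialValue χ x) →
      monomialValue χ (u C.o) • torusPoint (fun j => p • C.w j) t = torusPoint u χ := by
    intro t χ h
    funext j
    rw [Pi.smul_apply, torusPoint_apply, hw j, h, smul_eq_mul, torusPoint_apply, ← monomialValue_add,
      add_sub_cancel]
  ext P
  constructor
  · rintro ⟨t, ht, rfl⟩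
    let χ : Torus 𝕜 M'' := t.comap
      (p • (E.symm.toLinearMap ∘ₗ LinearMap.inr ℤ M' M'' ∘ₗ scaleBasis b i₀ c)).toAddMonoidHom
    refine ⟨χ, torusPoint_ne_zero _ _, ?_⟩
    have h1 := key t χ fun x => rfl
    refine ((Projectivization.mk_eq_mk_iff' 𝕜 _ _ _ _).mpr ⟨_, h1⟩).symm
  · rintro ⟨χ, hχ, rfl⟩
    have hroot : ∀ (x : 𝕜ˣ) (k : ℕ), 0 < k → ∃ y : 𝕜ˣ, y ^ k = x := fun x k hk => by
      obtain ⟨y, hy⟩ := IsAlgClosed.exists_pow_nat_eq (x : 𝕜) hk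
      have hy0 : y ≠ 0 := by
        rintro rfl
        rw [zero_pow hk.ne'] at hy
        exact x.ne_zero hy.symm
      exact ⟨Units.mk0 y hy0, Units.ext (by simpa using hy)⟩
    classical
    choose y hy using fun i => hroot (χ (Multiplicative.ofAdd (b i)))
      (p * if i = i₀ then c else 1) (by split_ifs <;> positivity)
    obtain ⟨η, hη⟩ := exists_torus_basis b y
    have hηχ : η.comap (p • scaleBasis b i₀ c).toAddMonoidHom = χ := by
      refine torus_ext_basis b fun i => ?_
      have hyi : (y i : 𝕜) ^ (p * if i = i₀ then c else 1) = monomialValue χ (b i) := by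
        rw [← Units.val_pow_eq_pow_val, hy]
        rfl
      change monomialValue η (p • scaleBasis b i₀ c (b i)) = _
      rw [monomialValue_nsmul, ← hyi]
      by_cases hi : i = i₀
      · subst hi
        rw [if_pos rfl, scaleBasis_self, monomialValue_zsmul, hη, zpow_natCast, ← pow_mul, mul_comm]
      · rw [if_neg hi, scaleBasis_of_ne b hi, hη, mul_one]
    let t : Torus 𝕜 (Fin n → ℤ) :=
      η.comap (LinearMap.snd ℤ M' M'' ∘ₗ E.toLinearMap).toAddMonoidHom
    refine ⟨t, torusPoint_ne_zero _ _, ?_⟩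
    have h1 := key t χ fun x => by
      rw [← hηχ]
      simp only [t, monomialValue_nsmul, monomialValue_comap]
      simp [monomialValue_nsmul]
    exact (Projectivization.mk_eq_mk_iff' 𝕜 _ _ _ _).mpr ⟨_, h1⟩

end SplitLattice

/-! ### Construction of A and proof of the theorem. -/

/-- A finite subset of the lattice enumerated by basis vectors and `p`-divisible vectors. -/
theorem exists_gaussConfig {p n m : ℕ} (hp : 1 < p) (w : Fin m → Fin n → ℤ)
    (hw : Function.Injective w) (o : Fin m) (ho : w o = 0) :
    ∃ A : Finset (Fin n → ℤ), A.card = n + m ∧ affineSpan ℤ (A : Set (Fin n → ℤ)) = ⊤ ∧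
      ∃ C : GaussConfig p n (Fin A.card) (Fin m), C.u = enum A ∧ C.w = w ∧ C.o = o := by
  classical
  let f : Fin n ⊕ Fin m → Fin n → ℤ := Sum.elim (fun i => Pi.single i 1) fun j => p • w j
  have hne : ∀ i j, (Pi.single i 1 : Fin n → ℤ) ≠ p • w j := fun i j h => by
    have h1 := congrFun h i
    simp only [Pi.single_eq_same, Pi.smul_apply, nsmul_eq_mul] at h1
    have h2 : (p : ℤ) ∣ 1 := ⟨_, h1⟩
    have h3 : p ∣ 1 := by exact_mod_cast h2
    exact hp.ne' (Nat.dvd_one.mp h3)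
  have hf : Function.Injective f := by
    rintro (i | i) (j | j) h
    · by_contra hij
      have h1 := congrFun h i
      have hij' : i ≠ j := fun h => hij (by rw [h])
      simp [f, hij'] at h1
    · exact absurd h (hne i j)
    · exact absurd h.symm (hne j i)
    · have h1 : p • w i = p • w j := h
      congr 1
      apply hw
      funext k
      have h2 := congrFun h1 k
      simp only [Pi.smul_apply, nsmul_eq_mul] at h2
      exact mul_left_cancel₀ (by exact_mod_cast (by omega : p ≠ 0)) h2
  let A : Finset (Fin n → ℤ) := Finset.univ.image f
  have hfA : ∀ x, f x ∈ A := fun x => Finset.mem_image_of_mem f (Finset.mem_univ x)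
  have hcard : A.card = n + m := by
    rw [Finset.card_image_of_injective _ hf, Finset.card_univ, Fintype.card_sum, Fintype.card_fin,
      Fintype.card_fin]
  let e : Fin n ⊕ Fin m ≃ A := Equiv.ofBijective (fun x => ⟨f x, hfA x⟩)
    ⟨fun x y h => hf (congrArg Subtype.val h), fun ⟨a, ha⟩ => by
      obtain ⟨x, -, rfl⟩ := Finset.mem_image.mp ha
      exact ⟨x, rfl⟩⟩
  have hu : ∀ x, enum A ((e.trans A.equivFin) x) = f x := fun x => by
    change ((A.equivFin.symm (A.equivFin (e x)) : A) : Fin n → ℤ) = f x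
    rw [Equiv.symm_apply_apply]
    rfl
  refine ⟨A, hcard, affineSpan_eq_top_of_single_mem ?_ ?_, ⟨enum A, e.trans A.equivFin, w, o,
    fun i => hu (Sum.inl i), fun j => hu (Sum.inr j), ho⟩, rfl, rfl, rfl⟩
  · have h0 := hfA (Sum.inr o)
    simpa [f, ho] using h0
  · exact fun i => hfA (Sum.inl i)

theorem surjective_constr_of_affineSpan {M : Type*} [AddCommGroup M] {A : Finset M} {n : ℕ}
    (hA : affineSpan ℤ (A : Set M) = ⊤) {o : M} (ho : o ∈ A) (q : Fin n → M)
    (hq : ∀ a ∈ A, a = o ∨ ∃ i, a = q i + o) :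
    Function.Surjective ((Pi.basisFun ℤ (Fin n)).constr ℤ q) := by
  set π := (Pi.basisFun ℤ (Fin n)).constr ℤ q
  have hπ : ∀ i, q i ∈ LinearMap.range π := fun i =>
    ⟨_, (Pi.basisFun ℤ (Fin n)).constr_basis ℤ q i⟩
  obtain ⟨k, hk⟩ : o ∈ Set.range (enum A) := by rw [range_enum]; exact ho
  intro x
  obtain ⟨z, rfl⟩ := exists_sum_smul_sub_eq (u := enum A) (by rw [range_enum, hA]) k x
  refine Submodule.sum_mem (LinearMap.range π) fun j _ => Submodule.smul_mem _ _ ?_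
  have hj : enum A j ∈ A := (A.equivFin.symm j).2
  rcases hq _ hj with h | ⟨i, h⟩
  · rw [h, hk, sub_self]
    exact Submodule.zero_mem _
  · rw [h, hk, add_sub_cancel_right]
    exact hπ i

end GaussToric

theorem theorem5p1
    {𝕜 : Type*} [Field 𝕜] [IsAlgClosed 𝕜] (p : ℕ) [CharP 𝕜 p] (hp : 0 < p)
    {M' : Type*} [AddCommGroup M'] [Module.Free ℤ M'] [Module.Finite ℤ M']
    {M'' : Type*} [AddCommGroup M''] [Module.Free ℤ M''] [Module.Finite ℤ M'']
    (A' : Finset M') (A'' : Finset M'')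
    (hA' : affineSpan ℤ (A' : Set M') = ⊤) (hA'' : affineSpan ℤ (A'' : Set M'') = ⊤)
    (c : ℕ) (hc : 0 < c) (hcp : Nat.Coprime c p)
    (n : ℕ) (hn : n = Module.finrank ℤ M' + Module.finrank ℤ M'')
    (hnA' : A'.card ≤ n + 1) (hM'' : 1 ≤ Module.finrank ℤ M'') :
    ∃ A : Finset (Fin n → ℤ),
      A.card = n + A''.card ∧
      affineSpan ℤ (A : Set (Fin n → ℤ)) = ⊤ ∧
      GaussToric.ForGeneralGaussFiber (GaussToric.toricVariety 𝕜 A)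
        (fun F => ∀ C ∈ irreducibleComponents F,
          GaussToric.ProjectivelyEquivalent
            (closure (Subtype.val '' C : Set (ℙ 𝕜 (Fin A.card → 𝕜))))
            (GaussToric.toricVariety 𝕜 A')) ∧
      GaussToric.ProjectivelyEquivalent
        (GaussToric.gaussImage (GaussToric.toricVariety 𝕜 A)) (GaussToric.toricVariety 𝕜 A'') ∧
      GaussToric.ForGeneralGaussFiber (GaussToric.toricVariety 𝕜 A)
        (fun F => (irreducibleComponents F).encard = c) := by
  classical
  open GaussToric in
  have hpp : p.Prime := (CharP.char_is_prime_or_zero 𝕜 p).resolve_right hp.ne'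
  have hne' : (A' : Set M').Nonempty := by
    rw [← affineSpan_nonempty ℤ, hA']
    exact ⟨0, trivial⟩
  have hne'' : (A'' : Set M'').Nonempty := by
    rw [← affineSpan_nonempty ℤ, hA'']
    exact ⟨0, trivial⟩
  obtain ⟨u₀', hu₀'⟩ := hne'
  obtain ⟨u₀'', hu₀''⟩ := hne''
  obtain ⟨o, rfl⟩ : u₀'' ∈ Set.range (enum A'') := by rw [range_enum]; exact hu₀''
  obtain ⟨q, hqA', hA'q⟩ := exists_fun_range_eq A' hnA' hu₀'
  obtain ⟨E, hE⟩ := exists_equiv_prod_of_surjective (M'' := M'') (by simpa using hn) _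
    (surjective_constr_of_affineSpan hA' hu₀' q hA'q)
  have hEi : ∀ i, (E (Pi.single i 1)).1 = q i := fun i => by
    rw [hE]
    have h1 := (Pi.basisFun ℤ (Fin n)).constr_basis ℤ q i
    rwa [Pi.basisFun_apply] at h1
  let b := Module.finBasis ℤ M''
  let i₀ : Fin (Module.finrank ℤ M'') := ⟨0, hM''⟩
  let w (j : Fin A''.card) : Fin n → ℤ :=
    E.symm (0, scaleBasis b i₀ c (enum A'' j - enum A'' o))
  have hwinj : Function.Injective w := by
    intro j k hjk
    have h1 := congrArg Prod.snd (E.symm.injective hjk)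
    exact enum_injective A''
      (sub_left_injective (scaleBasis_injective b i₀ (by exact_mod_cast hc.ne') h1))
  have hwo : w o = 0 := by
    simp only [w, sub_self, map_zero]
    exact map_zero E.symm
  obtain ⟨A, hcard, hspan, C, hCu, hCw, hCo⟩ := exists_gaussConfig hpp.one_lt w hwinj o hwo
  have hvar : C.variety 𝕜 = toricVariety 𝕜 A := by
    rw [GaussConfig.variety, hCu]
    rfl
  have hw : C.IsScaling E b i₀ c (enum A'') := fun j => by rw [hCw, hCo]
  have hu : affineSpan ℤ (Set.range (enum A'')) = ⊤ := by rw [range_enum, hA'']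
  have hmono := monomialImage_smul_w_eq (𝕜 := 𝕜) hw hp hc
  let π : (Fin n → ℤ) →+ M' := (LinearMap.fst ℤ M' M'' ∘ₗ E.toLinearMap).toAddMonoidHom
  let g : M' →+ (Fin n → ℤ) := (E.symm.toLinearMap ∘ₗ LinearMap.inl ℤ M' M'').toAddMonoidHom
  have : NeZero c := ⟨hc.ne'⟩
  have : NeZero (c : 𝕜) := ⟨fun h0 => by
    rw [CharP.cast_eq_zero_iff 𝕜 p] at h0
    exact hpp.one_lt.ne' (Nat.eq_one_of_dvd_coprimes hcp h0 dvd_rfl)⟩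
  have hπw : ∀ j, π (C.w j) = 0 := fun j => by
    rw [hw j]
    simp [π]
  have horbits := C.forGeneralGaussFiber_orbits hpp (separates hw hcp hc hpp hu)
    (fun v hv hv0 h => by
      rw [hmono] at h ⊢
      exact mk_mem_monomialImage_of_mem_closure hu o hv hv0 h)
    π g (fun x => by simp [π, g]) (fun j => by rw [map_nsmul, hπw, smul_zero])
    -- The components are indexed by the c-th roots of unity; there are c of them as c is invertible
    -- in 𝕜.
    (fun ω : rootsOfUnity c 𝕜 => rootTwist E b i₀ (ω : 𝕜ˣ))
    (fun ω => rootTwist_mem_fiberGroup hw ω.2)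
    (fun h hh => by
      obtain ⟨ω, hω, s, hs⟩ := exists_eq_rootTwist_mul_comap hw hpp hu hh
      exact ⟨⟨ω, hω⟩, s, hs⟩)
    (fun ω ω' s h => Subtype.ext (eq_of_rootTwist_eq_mul_comap h))
  rw [hvar] at horbits
  refine ⟨A, hcard, hspan, horbits.mono ?_, ?_, horbits.mono ?_⟩
  · rintro F ⟨t, hsub, hcov, hdisj⟩ Z hZ
    obtain ⟨k, hk⟩ := closure_image_of_mem_irreducibleComponents
      (fun k => C.isIrreducible_subtorusOrbit π (t k)) hsub hcov hdisj hZ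
    rw [hk]
    -- On an orbit of the torus of M' the exponents are π(e_i) = q_i and π(p w_j) = 0, which fill A'
    -- - u₀', possibly with repetitions.
    have hmem : ∀ i, π (C.u i) + u₀' ∈ A' := fun i => by
      obtain ⟨i | j, rfl⟩ := C.σ.surjective i
      · rw [C.u_inl]
        change (E _).1 + _ ∈ _
        rw [hEi]
        exact hqA' i
      · rw [C.u_inr, map_nsmul, hπw, smul_zero, zero_add]
        exact hu₀'
    have henum : ∀ a (ha : a ∈ A'), enum A' (A'.equivFin ⟨a, ha⟩) = a := fun a ha => by
      simp [enum]
    have := C.nonempty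
    refine closure_image_smul_projectivelyEquivalent (fun i => π (C.u i)) (enum A')
      (fun i => A'.equivFin ⟨_, hmem i⟩) (fun k => ?_) u₀' (fun i => ?_) (torusPoint C.u (t k))
      fun i => monomialValue_ne_zero _ _
    · obtain ⟨⟨a, ha⟩, rfl⟩ := A'.equivFin.surjective k
      rcases hA'q a ha with rfl | ⟨i, rfl⟩
      · refine ⟨C.σ (Sum.inr o), congrArg _ (Subtype.ext ?_)⟩
        change π (C.u _) + a = a
        rw [C.u_inr, map_nsmul, hπw, smul_zero, zero_add]
      · refine ⟨C.σ (Sum.inl i), congrArg _ (Subtype.ext ?_)⟩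
        change π (C.u _) + u₀' = q i + u₀'
        rw [C.u_inl]
        change (E _).1 + _ = _
        rw [hEi]
    · rw [henum, add_sub_cancel_right]
  · have himg := C.gaussImage_variety (𝕜 := 𝕜)
    rw [hmono] at himg
    -- Otherwise the Plücker space would be zero, while `pluckerMap` embeds the nonzero space of the
    -- y_j in it.
    have : Nonempty (Fin (coneDim (C.variety 𝕜)) ↪o Fin A.card) := by
      by_contra hempty
      rw [not_nonempty_iff] at hempty
      have h1 : (1 : Fin A''.card → 𝕜) = 0 :=
        C.pluckerMap_injective (C.coneDim_variety (𝕜 := 𝕜)) (Subsingleton.elim _ _)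
      exact one_ne_zero (congrFun h1 o)
    rw [← hvar]
    exact (projectivelyEquivalent_of_map _ (C.pluckerMap_injective C.coneDim_variety)
      himg.symm).symm
  · rintro F ⟨t, hsub, hcov, hdisj⟩
    have := Fintype.ofFinite (rootsOfUnity c 𝕜)
    rw [encard_irreducibleComponents (fun k => C.isIrreducible_subtorusOrbit (𝕜 := 𝕜) π (t k)) hsub
      hcov hdisj]
    congr 1
    rw [← Nat.card_eq_fintype_card, HasEnoughRootsOfUnity.natCard_rootsOfUnity]
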